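/- Let $f(y)=\sum_{j=0}^{d}a_jy^j\in\mathbb{Z}[y]$ have degree $d\ge 2$, map positive integers to positive integers, and satisfy $\gcd(a_0,\dots,a_d)=1$. Suppose that $$f(y)-a_0=a_d\,y\prod_{j=1}^{d-1}(y+\alpha_j)\quad\text{with real } \alpha_j\ge 0,$$ that $a_0\ge 0$, $a_1=0$, $a_{d-1}/a_d<d/2$, $a_0/a_d<1$, and that for every prime $p\le d$ the polynomial $f$ is non-constant as a function modulo $p$. Then $f$ is strictly increasing on $[0,\infty)$. For $U>0$ let $\psi(U)$ be the unique $x\ge 0$ with $f(x)=U$ if $U\ge f(0)$, and put $\psi(U)=0$ if $U<f(0)$. Write $e(x)=e^{2\pi i x}$ and $$\mathcal F(\Theta)=\sum_{1\le y\le\psi(U)}e(\Theta f(y)),\qquad \mathcal S(q,a,f)=\sum_{y=1}^{q}e\Big(\frac{af(y)}{q}\Big),\qquad v_f(\beta)=\int_0^{\psi(U)}e(\beta f(\gamma))\,d\gamma .$$ Then for every $\varepsilon>0$ there is a constant $C>0$, depending only on $f$ and $\varepsilon$, such that for all real $U>0$, all integers $a\ge 0$ and $q\ge 1$ with $\gcd(a,q)=1$,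 and all real $\Theta=a/q+\beta$ with $|\beta|\le 1/q$, $$\big|\mathcal F(\Theta)-q^{-1}\mathcal S(q,a,f)\,v_f(\beta)\big|\le C\,q^{1-2^{1-d}+\varepsilon}\,(1+U|\beta|)^{1/2}.$$ -/

import Mathlib

open Polynomial

/-- The value of an integer polynomial at a real number. -/
noncomputable def realEval (f : ℤ[X]) (x : ℝ) : ℝ :=
  aeval x f

/-- The standing hypotheses on the polynomial `f = ∑ a_j y ^ j`, of degree `d`. -/
structure IsAdmissible (f : ℤ[X]) : Prop where
  /-- `f` maps positive integers to positive integers -/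
  pos : ∀ n : ℕ, 0 < n → 0 < f.eval (n : ℤ)
  /-- `d ≥ 2` -/
  two_le : 2 ≤ f.natDegree
  /-- `(a_0, …, a_d) = 1` -/
  content_eq : f.content = 1
  /-- `f(y) - a_0 = a_d y ∏_{j=1}^{d-1} (y + α_j)` with real `α_j ≥ 0` -/
  roots : ∃ α : Fin (f.natDegree - 1) → ℝ, (∀ j, 0 ≤ α j) ∧
    f.map (Int.castRingHom ℝ) - C (f.coeff 0 : ℝ) =
      C (f.leadingCoeff : ℝ) * X * ∏ j, (X + C (α j))
  /-- `a_0 ≥ 0` -/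
  coeff_zero : 0 ≤ f.coeff 0
  /-- `a_1 = 0` -/
  coeff_one : f.coeff 1 = 0
  /-- `a_{d-1} / a_d < d / 2` -/
  coeff_pred : (f.coeff (f.natDegree - 1) : ℝ) / (f.leadingCoeff : ℝ) < (f.natDegree : ℝ) / 2
  /-- `a_0 / a_d < 1` -/
  coeff_zero_lt : (f.coeff 0 : ℝ) / (f.leadingCoeff : ℝ) < 1
  /-- `f` is non-constant as a function modulo `p`, for every prime `p ≤ d` -/
  nonconst : ∀ p : ℕ, p.Prime → p ≤ f.natDegree →
    ∃ m n : ℤ, ¬ f.eval m ≡ f.eval n [ZMOD p]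

/-- The inverse function `ψ` of `f` on the nonnegative reals. For `U ≥ f(0)` it is the
`x ≥ 0` with `f(x) = U`; for `U < f(0)` it is `0`. -/
noncomputable def psi (f : ℤ[X]) (U : ℝ) : ℝ :=
  sSup {x : ℝ | 0 ≤ x ∧ realEval f x ≤ U}

/-- `e(x) = exp(2 π i x)` -/
noncomputable def expTwoPi (x : ℝ) : ℂ :=
  Complex.exp (2 * Real.pi * Complex.I * x)

/-- `F(Θ) = ∑_{1 ≤ y ≤ ψ(U)} e(Θ f(y))` -/
noncomputable def expSum (f : ℤ[X]) (U Θ : ℝ) : ℂ :=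
  ∑ y ∈ Finset.Icc 1 ⌊psi f U⌋₊, expTwoPi (Θ * realEval f (y : ℝ))

/-- `S(q, a, b, f) = ∑_{y=1}^{q} e((a f(y) + b y) / q)` -/
noncomputable def gaussSumPoly (q : ℕ) (a b : ℤ) (f : ℤ[X]) : ℂ :=
  ∑ y ∈ Finset.Icc 1 q, expTwoPi (((a : ℝ) * realEval f (y : ℝ) + (b : ℝ) * (y : ℝ)) / (q : ℝ))

/-- `v_f(β) = ∫_0^{ψ(U)} e(β f(γ)) dγ` -/
noncomputable def vInt (f : ℤ[X]) (U β : ℝ) : ℂ :=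
  ∫ γ in (0 : ℝ)..psi f U, expTwoPi (β * realEval f γ)

/-- `V(Θ, q, a, f) = q⁻¹ S(q, a, f) v_f(Θ - a/q)`, where `S(q, a, f) = S(q, a, 0, f)` -/
noncomputable def majorArcApprox (f : ℤ[X]) (U Θ : ℝ) (q : ℕ) (a : ℤ) : ℂ :=
  (q : ℂ)⁻¹ * gaussSumPoly q a 0 f * vInt f U (Θ - (a : ℝ) / (q : ℝ))

theorem IsAdmissible.leadingCoeff_pos {f : ℤ[X]} (hf : IsAdmissible f) :
    0 < f.leadingCoeff := by
  have hd := hf.two_le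
  have h0 : f.leadingCoeff ≠ 0 := by
    intro h
    rw [leadingCoeff_eq_zero] at h
    simp [h] at hd
  by_contra hneg
  have hle : (f.leadingCoeff : ℝ) ≤ -1 := by
    have : f.leadingCoeff ≤ -1 := by omega
    exact_mod_cast this
  obtain ⟨α, hα, hfac⟩ := hf.roots
  have hc := hf.coeff_zero
  obtain ⟨n, hn⟩ : ∃ n : ℕ, f.coeff 0 + 1 = (n : ℤ) :=
    ⟨(f.coeff 0 + 1).toNat, by omega⟩
  have hn0 : 0 < n := by omega
  have hp := hf.pos n hn0
  have hev := congrArg (Polynomial.eval (n : ℝ)) hfac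
  have h1 : (f.map (Int.castRingHom ℝ)).eval (n : ℝ) = ((f.eval (n : ℤ) : ℤ) : ℝ) := by
    simp
  simp only [eval_sub, eval_mul, eval_C, eval_X, eval_prod, eval_add, h1] at hev
  have hnR : (1 : ℝ) ≤ n := by exact_mod_cast hn0
  have hprod : (1 : ℝ) ≤ ∏ j, ((n : ℝ) + α j) := by
    have h := Finset.prod_le_prod (s := Finset.univ) (f := fun _ => (1 : ℝ))
      (g := fun j => (n : ℝ) + α j) (fun _ _ => zero_le_one)
      (fun j _ => by have := hα j; linarith)
    simpa using h
  have hpR : (0 : ℝ) < ((f.eval (n : ℤ) : ℤ) : ℝ) := by exact_mod_cast hp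
  have hnR' : (f.coeff 0 : ℝ) + 1 = n := by exact_mod_cast hn
  have h3 : (n : ℝ) ≤ n * ∏ j, ((n : ℝ) + α j) := by nlinarith
  nlinarith

theorem IsAdmissible.strictMonoOn {f : ℤ[X]} (hf : IsAdmissible f) :
    StrictMonoOn (realEval f) (Set.Ici 0) := by
  obtain ⟨α, hα, hfac⟩ := hf.roots
  have hl : (0 : ℝ) < f.leadingCoeff := by exact_mod_cast hf.leadingCoeff_pos
  have key : ∀ x : ℝ, realEval f x = f.coeff 0 + f.leadingCoeff * x * ∏ j, (x + α j) := by
    intro x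
    have hev := congrArg (Polynomial.eval x) hfac
    simp only [eval_sub, eval_mul, eval_C, eval_X, eval_prod, eval_add] at hev
    have : realEval f x = (f.map (Int.castRingHom ℝ)).eval x := by
      rw [realEval, eval_map, aeval_def]; rfl
    linarith
  intro x hx y hy hxy
  have hx0 : (0 : ℝ) ≤ x := hx
  have hy0 : (0 : ℝ) < y := lt_of_le_of_lt hx0 hxy
  have hP : ∏ j, (x + α j) ≤ ∏ j, (y + α j) :=
    Finset.prod_le_prod (fun j _ => by have := hα j; linarith) (fun j _ => by linarith)
  have hPy : 0 < ∏ j, (y + α j) := Finset.prod_pos (fun j _ => by have := hα j; linarith)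
  have h1 : x * ∏ j, (x + α j) < y * ∏ j, (y + α j) := by nlinarith
  rw [key, key, mul_assoc, mul_assoc]
  nlinarith

/-- `ψ` is a left inverse of `f` on the nonnegative reals. -/
theorem psi_realEval {f : ℤ[X]} (hf : IsAdmissible f) {x : ℝ} (hx : 0 ≤ x) :
    psi f (realEval f x) = x := by
  have : {z : ℝ | 0 ≤ z ∧ realEval f z ≤ realEval f x} = Set.Icc 0 x := by
    ext z
    constructor
    · rintro ⟨h0, h1⟩
      exact ⟨h0, (hf.strictMonoOn.le_iff_le h0 hx).1 h1⟩
    · rintro ⟨h0, h1⟩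
      exact ⟨h0, (hf.strictMonoOn.le_iff_le h0 hx).2 h1⟩
  rw [psi, this, csSup_Icc hx]

/-! Put X = ψ(U). Orthogonality modulo q gives e(a f(y)/q) = q⁻¹ ∑_b S(q,a,b) e(-by/q), so F(Θ) =
q⁻¹ ∑_{b mod q} S(q,a,b) T(b) with T(b) = ∑_{1 ≤ y ≤ X} e(β f(y) - by/q). Replacing T(0) by v_f(β)
in the term b = 0 produces exactly the main term. Two bounds then suffice.

(1) Uniformly in b, S(q,a,b) ≪ q^{1-2^{1-d}+ε} (`exists_norm_gaussSumPoly_le`). Weyl differencing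
reduces the sum to complete linear sums, which are 0 or q. Counting the nonzero ones costs gcds and
the divisor function.

(2) |T(0) - v_f(β)| + ∑_{b≠0} |T(b)| ≪ q(1+log q)(1+√(X G'(X))) with G = βf (`exists_sum_norm_le`).
This is van der Corput's method: cut the range according to the integer nearest to G' - b/q, replace
each block by an integral with error O(1), and estimate the integrals by the first and second
derivative tests. The vanishing of a_1 and the nonnegativity of the coefficients give G' ≤ xG'',
which supplies the lower bound on G''.

Finally X f'(X) ≤ d U turns √(X G'(X)) into O((Uβ)^{1/2}), and log q is absorbed in q^ε. Negative β
reduces to positive β by complex conjugation. -/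

/-! ### Weyl differencing for complete sums modulo q. -/

/-- The number of `h ∈ (ℤ/q)^m` with `c * h₁ * ⋯ * h_m = 0`. -/
def prodZeroCount (q : ℕ) [NeZero q] : ℕ → ZMod q → ℕ
  | 0, c => if c = 0 then 1 else 0
  | m + 1, c => ∑ h : ZMod q, prodZeroCount q m (c * h)

/-- The complete exponential sum of a polynomial over `ℤ/q`. -/
noncomputable def completeSum {q : ℕ} [NeZero q] (g : (ZMod q)[X]) : ℂ :=
  ∑ y : ZMod q, ZMod.stdAddChar (g.eval y)

/-- Expand |S|² as a double sum and take the difference h of the two variables as a new variable;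
`taylor h g` is g(y + h). -/
theorem norm_completeSum_sq_le {q : ℕ} [NeZero q] (g : (ZMod q)[X]) :
    ‖completeSum g‖ ^ 2 ≤ ∑ h : ZMod q, ‖completeSum (taylor h g - g)‖ := by
  have key : completeSum g * (starRingEnd ℂ) (completeSum g) =
      ∑ h : ZMod q, completeSum (taylor h g - g) := by
    simp only [completeSum]
    rw [map_sum, Finset.sum_mul_sum, Finset.sum_comm, Finset.sum_comm (s := Finset.univ (α := ZMod q))
      (t := Finset.univ (α := ZMod q)) (f := fun h y => ZMod.stdAddChar (eval y (taylor h g - g)))]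
    refine Finset.sum_congr rfl fun y _ => ?_
    rw [← Equiv.sum_comp (Equiv.addLeft y)]
    refine Finset.sum_congr rfl fun h _ => ?_
    rw [← AddChar.map_neg_eq_conj, ← AddChar.map_add_eq_mul, eval_sub, taylor_eval, sub_eq_add_neg]
    rw [Equiv.coe_addLeft]
  have h2 : ‖completeSum g‖ ^ 2 = ‖completeSum g * (starRingEnd ℂ) (completeSum g)‖ := by
    rw [norm_mul, RCLike.norm_conj, sq]
  rw [h2, key]
  exact norm_sum_le _ _

theorem taylor_sub_natDegree_le {R : Type*} [CommRing R] {g : R[X]} {m : ℕ}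
    (hg : g.natDegree ≤ m + 1) (h : R) : (taylor h g - g).natDegree ≤ m := by
  rw [natDegree_le_iff_coeff_eq_zero]
  intro n hn
  rw [coeff_sub, taylor_coeff]
  have h1 : (hasseDeriv n g).natDegree ≤ 0 :=
    (natDegree_hasseDeriv_le g n).trans (by omega)
  rw [eq_C_of_natDegree_le_zero h1, eval_C, hasseDeriv_coeff]
  simp

/-- Each differencing multiplies the top coefficient by its degree and by h. Iterating yields the
factorial and the product h₁⋯h_m whose zeros `prodZeroCount` counts. -/
theorem taylor_sub_coeff {R : Type*} [CommRing R] {g : R[X]} {m : ℕ}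
    (hg : g.natDegree ≤ m + 1) (h : R) :
    (taylor h g - g).coeff m = (m + 1 : ℕ) * g.coeff (m + 1) * h := by
  rw [coeff_sub, taylor_coeff]
  have h1 : (hasseDeriv m g).natDegree ≤ 1 :=
    (natDegree_hasseDeriv_le g m).trans (by omega)
  rw [eq_X_add_C_of_natDegree_le_one h1]
  simp only [eval_add, eval_mul, eval_C, eval_X, hasseDeriv_coeff]
  have : (1 + m).choose m = m + 1 := by rw [add_comm, Nat.choose_succ_self_right]
  rw [this, add_comm 1 m]
  simp

theorem norm_completeSum_linear_le {q : ℕ} [NeZero q] {g : (ZMod q)[X]} (hg : g.natDegree ≤ 1) :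
    ‖completeSum g‖ ≤ q * prodZeroCount q 0 (g.coeff 1) := by
  have h1 : completeSum g =
      (∑ y : ZMod q, ZMod.stdAddChar (y * g.coeff 1)) * ZMod.stdAddChar (g.coeff 0) := by
    rw [completeSum, Finset.sum_mul]
    refine Finset.sum_congr rfl fun y _ => ?_
    rw [← AddChar.map_add_eq_mul]
    have h2 := congrArg (eval y) (eq_X_add_C_of_natDegree_le_one hg)
    rw [eval_add, eval_mul, eval_C, eval_X, eval_C] at h2
    rw [h2, mul_comm y]
  rw [h1, AddChar.sum_mulShift _ (ZMod.isPrimitive_stdAddChar q), norm_mul, AddChar.norm_apply,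
    mul_one, prodZeroCount]
  split_ifs <;> simp

/-- Weyl differencing for complete exponential sums. -/
theorem norm_completeSum_pow_le {q : ℕ} [NeZero q] (m : ℕ) :
    ∀ {g : (ZMod q)[X]}, g.natDegree ≤ m + 1 →
      ‖completeSum g‖ ^ (2 ^ m) * (q : ℝ) ^ m ≤
        (q : ℝ) ^ (2 ^ m) * prodZeroCount q m ((m + 1).factorial * g.coeff (m + 1)) := by
  induction m with
  | zero =>
    intro g hg
    simpa using norm_completeSum_linear_le hg
  | succ m ih =>
    intro g hg
    have hq : (0 : ℝ) ≤ q := Nat.cast_nonneg q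
    -- Hölder's inequality moves the power 2^m inside the sum over h, where the induction hypothesis
    -- applies.
    have hpow := pow_sum_le_card_mul_sum_pow (s := (Finset.univ : Finset (ZMod q)))
      (f := fun h => ‖completeSum (taylor h g - g)‖) (fun _ _ => norm_nonneg _) (2 ^ m - 1)
    have h2m : 2 ^ m - 1 + 1 = 2 ^ m := Nat.sub_add_cancel Nat.one_le_two_pow
    rw [h2m, Finset.card_univ, ZMod.card] at hpow
    calc ‖completeSum g‖ ^ (2 ^ (m + 1)) * (q : ℝ) ^ (m + 1)
        = (‖completeSum g‖ ^ 2) ^ (2 ^ m) * (q : ℝ) ^ (m + 1) := by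
          rw [← pow_mul, pow_succ' 2 m]
      _ ≤ (∑ h : ZMod q, ‖completeSum (taylor h g - g)‖) ^ (2 ^ m) * (q : ℝ) ^ (m + 1) := by
          gcongr
          exact norm_completeSum_sq_le g
      _ ≤ ((q : ℝ) ^ (2 ^ m - 1) * ∑ h : ZMod q, ‖completeSum (taylor h g - g)‖ ^ (2 ^ m)) *
            (q : ℝ) ^ (m + 1) := by
          gcongr
      _ = (q : ℝ) ^ (2 ^ m - 1 + 1) *
            ∑ h : ZMod q, (‖completeSum (taylor h g - g)‖ ^ (2 ^ m) * (q : ℝ) ^ m) := by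
          rw [← Finset.sum_mul]; ring
      _ ≤ (q : ℝ) ^ (2 ^ m - 1 + 1) * ∑ h : ZMod q, ((q : ℝ) ^ (2 ^ m) *
            prodZeroCount q m (((m + 1 + 1).factorial * g.coeff (m + 1 + 1)) * h)) := by
          refine mul_le_mul_of_nonneg_left (Finset.sum_le_sum fun h _ => ?_) (by positivity)
          refine (ih (taylor_sub_natDegree_le hg h)).trans_eq ?_
          rw [taylor_sub_coeff hg]
          congr 3
          rw [Nat.factorial_succ (m + 1)]
          push_cast
          ring
      _ = _ := by
          rw [h2m, ← Finset.mul_sum, prodZeroCount, Nat.cast_sum, pow_succ' 2 m, two_mul, pow_add]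
          ring

/-- With g = gcd(c, q), the solutions h are the multiples of q/g in [0, q); dividing by q/g injects
them into `range g`. -/
theorem card_mul_eq_zero_le {q : ℕ} [NeZero q] (c : ZMod q) :
    prodZeroCount q 1 c ≤ Nat.gcd c.val q := by
  have hq : 0 < q := NeZero.pos q
  simp only [prodZeroCount]
  rw [← Finset.card_filter]
  set g := Nat.gcd c.val q with hg
  have hg0 : 0 < g := Nat.gcd_pos_of_pos_right _ hq
  have hgq : g ∣ q := Nat.gcd_dvd_right _ _
  have hdvd : ∀ h : ZMod q, c * h = 0 → q / g ∣ h.val := by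
    intro h hh
    have h1 : ((c.val * h.val : ℕ) : ZMod q) = 0 := by
      push_cast; simpa using hh
    rw [ZMod.natCast_eq_zero_iff] at h1
    have h2 : q / g ∣ (c.val / g) * h.val := by
      have h3 : c.val * h.val = g * ((c.val / g) * h.val) := by
        rw [← mul_assoc, Nat.mul_div_cancel' (Nat.gcd_dvd_left _ _)]
      refine (Nat.mul_dvd_mul_iff_left hg0).1 ?_
      rwa [Nat.mul_div_cancel' hgq, ← h3]
    exact (Nat.Coprime.symm (Nat.coprime_div_gcd_div_gcd hg0)).dvd_of_dvd_mul_left h2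
  have hqg : 0 < q / g := Nat.div_pos (Nat.le_of_dvd hq hgq) hg0
  rw [← Finset.card_range g]
  refine Finset.card_le_card_of_injOn (fun h => h.val / (q / g)) ?_ ?_
  · intro h _
    simp only [Finset.coe_range, Set.mem_Iio]
    rw [Nat.div_lt_iff_lt_mul hqg, Nat.mul_div_cancel' hgq]
    exact ZMod.val_lt h
  · intro h hh k hk hhk
    simp only [Finset.coe_filter, Finset.mem_univ, true_and, Set.mem_ofPred_eq] at hh hk
    apply ZMod.val_injective q
    have := congrArg (fun t => q / g * t) hhk
    simpa [Nat.mul_div_cancel' (hdvd h hh), Nat.mul_div_cancel' (hdvd k hk)] using this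

/-- Grouping by the value g of the gcd gives ∑_{g ∣ q} g φ(q/g), and each term is at most q. -/
theorem sum_gcd_le (q : ℕ) [NeZero q] :
    ∑ h : ZMod q, Nat.gcd h.val q ≤ q * q.divisors.card := by
  have hq : q ≠ 0 := NeZero.ne q
  have h1 : ∑ h : ZMod q, Nat.gcd h.val q = ∑ k ∈ Finset.range q, Nat.gcd q k := by
    refine Finset.sum_bij (fun h _ => h.val) (fun h _ => Finset.mem_range.2 (ZMod.val_lt h))
      (fun _ _ _ _ h => ZMod.val_injective q h)
      (fun k hk => ⟨k, Finset.mem_univ _, ZMod.val_cast_of_lt (Finset.mem_range.1 hk)⟩)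
      (fun h _ => Nat.gcd_comm _ _)
  rw [h1, ← Finset.sum_fiberwise_of_maps_to (t := q.divisors) (g := fun k => Nat.gcd q k)
    (fun k _ => Nat.mem_divisors.2 ⟨Nat.gcd_dvd_left _ _, hq⟩), mul_comm, ← smul_eq_mul]
  refine Finset.sum_le_card_nsmul _ _ _ fun g hg => ?_
  have hgq := Nat.dvd_of_mem_divisors hg
  calc ∑ k ∈ Finset.range q with Nat.gcd q k = g, Nat.gcd q k
      = ∑ k ∈ Finset.range q with Nat.gcd q k = g, g :=
        Finset.sum_congr rfl fun k hk => (Finset.mem_filter.1 hk).2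
    _ = Nat.totient (q / g) * g := by
        rw [Finset.sum_const, smul_eq_mul, Nat.totient_div_of_dvd hgq]
    _ ≤ q / g * g := Nat.mul_le_mul_right _ (Nat.totient_le _)
    _ = q := Nat.div_mul_cancel hgq

/-- Induction on the number of variables: gcd(ch, q) ≤ gcd(c, q) gcd(h, q), and summing over h costs
q τ(q). The last variable is counted exactly by a gcd, which is where one full factor q is saved. -/
theorem prodZeroCount_succ_le (q : ℕ) [NeZero q] (m : ℕ) :
    ∀ c : ZMod q, prodZeroCount q (m + 1) c ≤ Nat.gcd c.val q * (q * q.divisors.card) ^ m := by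
  induction m with
  | zero => intro c; simpa using card_mul_eq_zero_le c
  | succ m ih =>
    intro c
    have hmul : ∀ h : ZMod q, Nat.gcd (c * h).val q ≤ Nat.gcd c.val q * Nat.gcd h.val q := by
      intro h
      rw [ZMod.val_mul, ← Nat.gcd_rec, Nat.gcd_comm c.val, Nat.gcd_comm h.val]
      exact Nat.le_of_dvd (Nat.mul_pos (Nat.gcd_pos_of_pos_left _ (NeZero.pos q))
        (Nat.gcd_pos_of_pos_left _ (NeZero.pos q))) (Nat.gcd_mul_right_dvd_mul_gcd _ _ _)
    calc prodZeroCount q (m + 1 + 1) c = ∑ h : ZMod q, prodZeroCount q (m + 1) (c * h) := rfl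
      _ ≤ ∑ h : ZMod q, (Nat.gcd c.val q * Nat.gcd h.val q) * (q * q.divisors.card) ^ m :=
        Finset.sum_le_sum fun h _ => (ih _).trans (Nat.mul_le_mul_right _ (hmul h))
      _ = Nat.gcd c.val q * (∑ h : ZMod q, Nat.gcd h.val q) * (q * q.divisors.card) ^ m := by
        rw [← Finset.sum_mul, ← Finset.mul_sum]
      _ ≤ Nat.gcd c.val q * (q * q.divisors.card) * (q * q.divisors.card) ^ m := by
        gcongr
        exact sum_gcd_le q
      _ = _ := by rw [pow_succ' _ m, mul_assoc]

/-! ### The divisor bound and the resulting bound for S(q, a, b, f). -/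

/-- Compare Euler factors. If p ≥ 2^{1/ε} then p^ε ≥ 2 and e + 1 ≤ 2^e ≤ p^{εe}. Each of the fewer
than P smaller primes loses at most a factor K, by Bernoulli's inequality; hence the constant K^P.
-/
theorem exists_card_divisors_le {ε : ℝ} (hε : 0 < ε) :
    ∃ C : ℝ, 1 ≤ C ∧ ∀ n : ℕ, 0 < n → (n.divisors.card : ℝ) ≤ C * (n : ℝ) ^ ε := by
  obtain ⟨P, hP⟩ := exists_nat_ge ((2 : ℝ) ^ (1 / ε))
  have hlog : 0 < Real.log 2 := Real.log_pos one_lt_two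
  set K : ℝ := 1 + 1 / (ε * Real.log 2) with hK
  have hK1 : 1 ≤ K := by rw [hK]; have : 0 < 1 / (ε * Real.log 2) := by positivity
                         linarith
  have hbase : ∀ p e : ℕ, p.Prime →
      ((e : ℝ) + 1) ≤ (if p < P then K else 1) * ((p : ℝ) ^ ε) ^ e := by
    intro p e hp
    have hp2 : (2 : ℝ) ≤ p := by exact_mod_cast hp.two_le
    split_ifs with h
    · have h1 : (2 : ℝ) ^ ε ≤ (p : ℝ) ^ ε := Real.rpow_le_rpow (by norm_num) hp2 hε.le
      have h2 : 1 + ε * Real.log 2 ≤ (2 : ℝ) ^ ε := by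
        rw [Real.rpow_def_of_pos two_pos]
        have := Real.add_one_le_exp (Real.log 2 * ε)
        linarith
      have h3 : 1 + e * (ε * Real.log 2) ≤ ((p : ℝ) ^ ε) ^ e := by
        refine (one_add_mul_le_pow (a := ε * Real.log 2) ?_ e).trans ?_
        · have : 0 < ε * Real.log 2 := by positivity
          linarith
        · exact pow_le_pow_left₀ (by positivity) (h2.trans h1) e
      have hx : 0 < ε * Real.log 2 := by positivity
      calc (e : ℝ) + 1 ≤ K * (1 + e * (ε * Real.log 2)) := by
            have : K * (1 + e * (ε * Real.log 2)) =
              1 + e + (1 / (ε * Real.log 2) + e * (ε * Real.log 2)) := by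
              rw [hK]; field_simp; ring
            rw [this]
            have : 0 ≤ 1 / (ε * Real.log 2) + e * (ε * Real.log 2) := by positivity
            linarith
        _ ≤ _ := by gcongr
    · have h1 : (2 : ℝ) ≤ (p : ℝ) ^ ε := by
        have hle : (2 : ℝ) ^ (1 / ε) ≤ p := hP.trans (by exact_mod_cast not_lt.1 h)
        calc (2 : ℝ) = ((2 : ℝ) ^ (1 / ε)) ^ ε := by
              rw [← Real.rpow_mul (by norm_num), one_div_mul_cancel hε.ne', Real.rpow_one]
          _ ≤ _ := Real.rpow_le_rpow (by positivity) hle hε.le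
      have h2 : (e : ℝ) + 1 ≤ 2 ^ e := by exact_mod_cast Nat.lt_two_pow_self
      rw [one_mul]
      exact h2.trans (pow_le_pow_left₀ (by norm_num) h1 e)
  refine ⟨K ^ P, one_le_pow₀ hK1, fun n hn => ?_⟩
  rw [Nat.card_divisors hn.ne', Nat.cast_prod]
  have hn' : (n : ℝ) ^ ε = ∏ p ∈ n.primeFactors, ((p : ℝ) ^ ε) ^ n.factorization p := by
    conv_lhs => rw [← Nat.prod_factorization_pow_eq_self hn.ne']
    rw [Finsupp.prod, Nat.support_factorization, Nat.cast_prod,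
      ← Real.finsetProd_rpow _ _ (fun _ _ => Nat.cast_nonneg _)]
    refine Finset.prod_congr rfl fun p _ => ?_
    rw [Nat.cast_pow, ← Real.rpow_natCast, ← Real.rpow_natCast, ← Real.rpow_mul (by positivity),
      ← Real.rpow_mul (by positivity), mul_comm]
  have hC : ∏ p ∈ n.primeFactors, (if p < P then K else 1) ≤ K ^ P := by
    rw [Finset.prod_ite, Finset.prod_const, Finset.prod_const_one, mul_one]
    refine pow_le_pow_right₀ hK1 ?_
    refine le_of_le_of_eq ?_ (Finset.card_range P)
    exact Finset.card_le_card fun p hp => Finset.mem_range.2 (Finset.mem_filter.1 hp).2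
  calc ∏ p ∈ n.primeFactors, ((n.factorization p + 1 : ℕ) : ℝ)
      ≤ ∏ p ∈ n.primeFactors,
          ((if p < P then K else 1) * ((p : ℝ) ^ ε) ^ n.factorization p) := by
        refine Finset.prod_le_prod (fun _ _ => by positivity) fun p hp => ?_
        push_cast
        exact hbase p _ (Nat.prime_of_mem_primeFactors hp)
    _ ≤ K ^ P * (n : ℝ) ^ ε := by
        rw [Finset.prod_mul_distrib, ← hn']
        gcongr

theorem realEval_intCast (f : ℤ[X]) (n : ℤ) : realEval f n = f.eval n := by
  rw [realEval, aeval_def, eval₂_at_intCast]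
  simp

theorem expTwoPi_intCast_div (q : ℕ) [NeZero q] (n : ℤ) :
    expTwoPi ((n : ℝ) / q) = ZMod.stdAddChar (n : ZMod q) := by
  rw [ZMod.stdAddChar_coe, expTwoPi]
  congr 1
  push_cast
  ring

theorem sum_range_eq_sum_zmod {M : Type*} [AddCommMonoid M] (q : ℕ) [NeZero q] (F : ZMod q → M) :
    ∑ k ∈ Finset.range q, F (k : ZMod q) = ∑ y : ZMod q, F y := by
  symm
  exact Finset.sum_bij (fun h _ => h.val) (fun h _ => Finset.mem_range.2 (ZMod.val_lt h))
    (fun _ _ _ _ h => ZMod.val_injective q h)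
    (fun k hk => ⟨k, Finset.mem_univ _, ZMod.val_cast_of_lt (Finset.mem_range.1 hk)⟩)
    (fun h _ => by rw [ZMod.natCast_zmod_val])

theorem sum_Icc_eq_sum_zmod {M : Type*} [AddCommMonoid M] (q : ℕ) [NeZero q] (F : ZMod q → M) :
    ∑ y ∈ Finset.Icc 1 q, F (y : ZMod q) = ∑ y : ZMod q, F y := by
  have hq : 1 ≤ q := NeZero.pos q
  rw [← sum_range_eq_sum_zmod, ← Finset.Ico_add_one_right_eq_Icc, Finset.sum_Ico_succ_top hq,
    Finset.range_eq_Ico, Finset.sum_eq_sum_Ico_succ_bot (NeZero.pos q), add_comm]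
  simp

theorem gaussSumPoly_eq_completeSum (q : ℕ) [NeZero q] (a b : ℤ) (f : ℤ[X]) :
    gaussSumPoly q a b f = completeSum ((C a * f + C b * X).map (Int.castRingHom (ZMod q))) := by
  rw [completeSum, ← sum_Icc_eq_sum_zmod, gaussSumPoly]
  refine Finset.sum_congr rfl fun y _ => ?_
  have h1 : (a : ℝ) * realEval f (y : ℝ) + (b : ℝ) * (y : ℝ) =
      ((a * f.eval (y : ℤ) + b * y : ℤ) : ℝ) := by
    have := realEval_intCast f y
    push_cast at this ⊢
    rw [this]
  rw [h1, expTwoPi_intCast_div]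
  congr 1
  have := eval_intCast_map (Int.castRingHom (ZMod q)) (C a * f + C b * X) (y : ℤ)
  rw [Int.cast_natCast] at this
  rw [this]
  simp

theorem exists_norm_gaussSumPoly_le {f : ℤ[X]} (hd : 2 ≤ f.natDegree) {ε : ℝ} (hε : 0 < ε) :
    ∃ K : ℝ, 0 < K ∧ ∀ q : ℕ, 0 < q → ∀ a b : ℤ, IsCoprime a (q : ℤ) →
      ‖gaussSumPoly q a b f‖ ≤ K * (q : ℝ) ^ (1 - (2 : ℝ) ^ (1 - (f.natDegree : ℝ)) + ε) := by
  obtain ⟨T, hT1, hT⟩ := exists_card_divisors_le hε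
  obtain ⟨m, hm⟩ : ∃ m, f.natDegree = m + 2 := ⟨f.natDegree - 2, by omega⟩
  set l := f.leadingCoeff with hl
  have hl0 : l ≠ 0 := by
    intro h
    rw [hl, leadingCoeff_eq_zero] at h
    simp [h] at hd
  set A : ℕ := (m + 2).factorial * l.natAbs with hA
  have hA0 : 0 < A := Nat.mul_pos (Nat.factorial_pos _) (Int.natAbs_pos.2 hl0)
  have hA0' : (0 : ℝ) < A := by exact_mod_cast hA0
  have hT0 : 0 < T := by linarith
  set B : ℝ := A * T ^ m with hB
  have hB0 : 0 < B := by positivity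
  set n : ℕ := 2 ^ (m + 1) with hn
  have hn0 : 0 < n := by positivity
  have hnR : (n : ℝ) ≠ 0 := by positivity
  refine ⟨B ^ (1 / (n : ℝ)), by positivity, fun q hq a b hab => ?_⟩
  have : NeZero q := ⟨hq.ne'⟩
  have hqR : (1 : ℝ) ≤ q := by exact_mod_cast hq
  have hq0 : (0 : ℝ) < q := by linarith
  rw [gaussSumPoly_eq_completeSum]
  set g := (C a * f + C b * X).map (Int.castRingHom (ZMod q)) with hg
  have hgdeg : g.natDegree ≤ m + 1 + 1 := by
    refine natDegree_map_le.trans (natDegree_add_le_of_degree_le ?_ ?_)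
    · exact (natDegree_C_mul_le _ _).trans hm.le
    · exact (natDegree_C_mul_le _ _).trans (natDegree_X_le.trans (by omega))
  have hcoeff : ((m + 1 + 1).factorial : ZMod q) * g.coeff (m + 1 + 1) =
      (((m + 2).factorial * l * a : ℤ) : ZMod q) := by
    have h1 : f.coeff (m + 1 + 1) = l := by rw [hl, leadingCoeff, hm]
    rw [hg, coeff_map, coeff_add, coeff_C_mul, coeff_C_mul, h1, coeff_X]
    simp
    ring
  -- Since a is coprime to q, only d! times the leading coefficient can share factors with q, so
  -- this gcd is bounded in terms of f alone.
  have hgcd : Nat.gcd (((m + 2).factorial * l * a : ℤ) : ZMod q).val q ≤ A := by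
    have h1 : Nat.gcd (((m + 2).factorial * l * a : ℤ) : ZMod q).val q =
        Int.gcd ((m + 2).factorial * l * a) q := by
      rw [← Int.gcd_natCast_natCast, ZMod.val_intCast, Int.gcd_comm, Int.gcd_comm _ (q : ℤ)]
      refine Nat.dvd_antisymm (Int.dvd_gcd (Int.gcd_dvd_left _ _) ?_)
        (Int.dvd_gcd (Int.gcd_dvd_left _ _) ?_)
      · conv_rhs => rw [← Int.mul_ediv_add_emod ((m + 2).factorial * l * a) q]
        exact dvd_add ((Int.gcd_dvd_left _ _).mul_right _) (Int.gcd_dvd_right _ _)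
      · rw [Int.emod_def]
        exact dvd_sub (Int.gcd_dvd_right _ _) ((Int.gcd_dvd_left _ _).mul_right _)
    have h2 : Int.gcd ((m + 2).factorial * l * a) q ∣ A := by
      have h3 : (Int.gcd ((m + 2).factorial * l * a) q : ℤ) ∣ (m + 2).factorial * l := by
        exact (hab.symm.of_isCoprime_of_dvd_left (Int.gcd_dvd_right _ _)).dvd_of_dvd_mul_right
          (Int.gcd_dvd_left _ _)
      have := Int.natAbs_dvd_natAbs.2 h3
      simpa [hA, Int.natAbs_mul] using this
    rw [h1]
    exact Nat.le_of_dvd hA0 h2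
  have hmain := norm_completeSum_pow_le (q := q) (m + 1) hgdeg
  rw [hcoeff] at hmain
  have hcount : (prodZeroCount q (m + 1) (((m + 2).factorial * l * a : ℤ) : ZMod q) : ℝ) ≤
      B * (q : ℝ) ^ (m + m * ε) := by
    have h1 := prodZeroCount_succ_le q m (((m + 2).factorial * l * a : ℤ) : ZMod q)
    have h2 : (prodZeroCount q (m + 1) (((m + 2).factorial * l * a : ℤ) : ZMod q) : ℝ) ≤
        (A : ℝ) * ((q : ℝ) * q.divisors.card) ^ m := by
      exact_mod_cast h1.trans (Nat.mul_le_mul_right _ hgcd)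
    calc _ ≤ (A : ℝ) * ((q : ℝ) * q.divisors.card) ^ m := h2
      _ ≤ (A : ℝ) * ((q : ℝ) * (T * (q : ℝ) ^ ε)) ^ m := by
        gcongr
        exact hT q hq
      _ = B * (q : ℝ) ^ (m + m * ε) := by
        rw [hB, Real.rpow_add hq0, Real.rpow_natCast, mul_comm (m : ℝ) ε, Real.rpow_mul hq0.le,
          Real.rpow_natCast]
        ring
  -- With n = 2^{d-1}, the n-th root of this bound gives the exponent 1 - 1/n + (m/n)ε, and m ≤ n.
  have hfin : ‖completeSum g‖ ^ n ≤ B * (q : ℝ) ^ ((n : ℝ) - 1 + m * ε) := by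
    have h1 : ‖completeSum g‖ ^ n * (q : ℝ) ^ (m + 1) ≤
        (q : ℝ) ^ n * (B * (q : ℝ) ^ (m + m * ε)) :=
      hmain.trans (by gcongr)
    have h2 : (q : ℝ) ^ n * (B * (q : ℝ) ^ (m + m * ε)) =
        B * (q : ℝ) ^ ((n : ℝ) - 1 + m * ε) * (q : ℝ) ^ (m + 1) := by
      rw [← Real.rpow_natCast (q : ℝ) n, ← Real.rpow_natCast (q : ℝ) (m + 1), mul_assoc B,
        ← Real.rpow_add hq0, mul_left_comm, ← Real.rpow_add hq0]
      congr 2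
      push_cast
      ring
    rw [h2] at h1
    exact le_of_mul_le_mul_right h1 (by positivity)
  have hroot : ‖completeSum g‖ ≤ (B * (q : ℝ) ^ ((n : ℝ) - 1 + m * ε)) ^ (1 / (n : ℝ)) := by
    have h1 := Real.rpow_le_rpow (by positivity) hfin (z := 1 / (n : ℝ)) (by positivity)
    rwa [← Real.rpow_natCast, ← Real.rpow_mul (norm_nonneg _), mul_one_div_cancel hnR,
      Real.rpow_one] at h1
  refine hroot.trans ?_
  rw [Real.mul_rpow hB0.le (by positivity), ← Real.rpow_mul hq0.le]
  refine mul_le_mul_of_nonneg_left (Real.rpow_le_rpow_of_exponent_le hqR ?_) (by positivity)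
  · have h2 : (2 : ℝ) ^ (1 - (f.natDegree : ℝ)) = 1 / n := by
      rw [hm, hn, one_div]
      push_cast
      rw [← Real.rpow_natCast, ← Real.rpow_neg (by norm_num)]
      congr 1
      push_cast
      ring
    have h3 : (m : ℝ) ≤ n := by
      have : m < 2 ^ m := Nat.lt_two_pow_self
      have : 2 ^ m ≤ 2 ^ (m + 1) := Nat.pow_le_pow_right (by norm_num) (by omega)
      exact_mod_cast (by omega : m ≤ 2 ^ (m + 1))
    rw [h2]
    have h4 : ((n : ℝ) - 1 + m * ε) * (1 / n) = 1 - 1 / n + m / n * ε := by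
      field_simp
    rw [h4]
    have h5 : (m : ℝ) / n ≤ 1 := (div_le_one (by positivity)).2 h3
    nlinarith

/-! ### The function e(x) and the derivative tests for oscillatory integrals. -/

theorem norm_expTwoPi (x : ℝ) : ‖expTwoPi x‖ = 1 := by
  rw [expTwoPi, show (2 * Real.pi * Complex.I * x : ℂ) = ((2 * Real.pi * x : ℝ) : ℂ) * Complex.I by
    push_cast; ring]
  exact Complex.norm_exp_ofReal_mul_I _

theorem expTwoPi_add (x y : ℝ) : expTwoPi (x + y) = expTwoPi x * expTwoPi y := by
  rw [expTwoPi, expTwoPi, expTwoPi, ← Complex.exp_add]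
  congr 1
  push_cast
  ring

theorem expTwoPi_zero : expTwoPi 0 = 1 := by simp [expTwoPi]

theorem expTwoPi_intCast (n : ℤ) : expTwoPi n = 1 := by
  rw [expTwoPi, ← Complex.exp_int_mul_two_pi_mul_I n]
  congr 1
  push_cast
  ring

theorem conj_expTwoPi (x : ℝ) : (starRingEnd ℂ) (expTwoPi x) = expTwoPi (-x) := by
  rw [expTwoPi, expTwoPi, ← Complex.exp_conj]
  congr 1
  simp [Complex.conj_ofNat]

theorem continuous_expTwoPi : Continuous expTwoPi := by
  unfold expTwoPi
  fun_prop

theorem norm_expTwoPi_sub_one_le (x : ℝ) : ‖expTwoPi x - 1‖ ≤ 2 * Real.pi * |x| := by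
  have := Real.norm_exp_I_mul_ofReal_sub_one_le (x := 2 * Real.pi * x)
  rw [Real.norm_eq_abs, abs_mul, abs_of_pos Real.two_pi_pos] at this
  rw [expTwoPi]
  convert this using 4
  push_cast
  ring

theorem norm_expTwoPi_sub_le (x y : ℝ) : ‖expTwoPi x - expTwoPi y‖ ≤ 2 * Real.pi * |x - y| := by
  have : expTwoPi x - expTwoPi y = expTwoPi y * (expTwoPi (x - y) - 1) := by
    rw [mul_sub, ← expTwoPi_add]; simp
  rw [this, norm_mul, norm_expTwoPi, one_mul]
  exact norm_expTwoPi_sub_one_le _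

theorem hasDerivAt_expTwoPi_comp {φ : ℝ → ℝ} {φ' x : ℝ} (h : HasDerivAt φ φ' x) :
    HasDerivAt (fun t => expTwoPi (φ t)) (2 * Real.pi * Complex.I * φ' * expTwoPi (φ x)) x := by
  have h1 : HasDerivAt (fun t => expTwoPi (φ t)) _ x :=
    ((h.ofReal_comp).const_mul (2 * Real.pi * Complex.I : ℂ)).cexp
  convert h1 using 1
  have h2 : expTwoPi (φ x) = Complex.exp (2 * Real.pi * Complex.I * φ x) := rfl
  rw [h2]
  ring

theorem intervalIntegrable_expTwoPi {φ : ℝ → ℝ} (hφ : Continuous φ) (a b : ℝ) :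
    IntervalIntegrable (fun t => expTwoPi (φ t)) MeasureTheory.volume a b :=
  (continuous_expTwoPi.comp hφ).intervalIntegrable a b

theorem norm_integral_expTwoPi_le_sub {φ : ℝ → ℝ} {a b : ℝ} (hab : a ≤ b) :
    ‖∫ t in a..b, expTwoPi (φ t)‖ ≤ b - a := by
  have := intervalIntegral.norm_integral_le_of_norm_le_const (a := a) (b := b) (C := 1)
    (f := fun t => expTwoPi (φ t)) (fun x _ => (norm_expTwoPi _).le)
  rwa [one_mul, abs_of_nonneg (sub_nonneg.2 hab)] at this

/-- The first derivative test for oscillatory integrals with convex phase. -/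
theorem norm_integral_expTwoPi_le_of_le_abs_deriv {φ φ₁ φ₂ : ℝ → ℝ}
    (h₁ : ∀ x, HasDerivAt φ (φ₁ x) x) (h₂ : ∀ x, HasDerivAt φ₁ (φ₂ x) x) (hc : Continuous φ₂)
    {a b : ℝ} (hab : a ≤ b) (hconv : ∀ x ∈ Set.Icc a b, 0 ≤ φ₂ x) {μ : ℝ} (hμ : 0 < μ)
    (hφ : ∀ x ∈ Set.Icc a b, μ ≤ |φ₁ x|) :
    ‖∫ t in a..b, expTwoPi (φ t)‖ ≤ 1 / μ := by
  have hpi := Real.two_pi_pos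
  have hne : ∀ x ∈ Set.Icc a b, φ₁ x ≠ 0 := fun x hx h => by
    have := hφ x hx
    rw [h, abs_zero] at this
    linarith
  have hφc : Continuous φ := continuous_iff_continuousAt.2 fun x => (h₁ x).continuousAt
  have hφ₁c : Continuous φ₁ := continuous_iff_continuousAt.2 fun x => (h₂ x).continuousAt
  have huIcc : Set.uIcc a b = Set.Icc a b := Set.uIcc_of_le hab
  set c : ℂ := (2 * Real.pi * Complex.I)⁻¹ with hcdef
  have hpine : (2 * Real.pi * Complex.I : ℂ) ≠ 0 := by
    simp [Real.pi_ne_zero]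
  have hcnorm : ‖c‖ = 1 / (2 * Real.pi) := by
    rw [hcdef, norm_inv, norm_mul, norm_mul, Complex.norm_I, mul_one, Complex.norm_real]
    simp [abs_of_pos Real.pi_pos]
  -- Integrate by parts with weight 1/φ'. Convexity makes the derivative of the weight nonpositive,
  -- so its total variation is just w(a) - w(b) ≤ 2/μ.
  set w : ℝ → ℝ := fun x => (φ₁ x)⁻¹
  have hw : ∀ x ∈ Set.Icc a b, HasDerivAt w (-φ₂ x / φ₁ x ^ 2) x := fun x hx =>
    (h₂ x).inv (hne x hx)
  have hwc : ContinuousOn (fun x => -φ₂ x / φ₁ x ^ 2) (Set.Icc a b) :=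
    (hc.neg.continuousOn).div (hφ₁c.pow 2).continuousOn fun x hx => pow_ne_zero 2 (hne x hx)
  have hwi : IntervalIntegrable (fun x => -φ₂ x / φ₁ x ^ 2) MeasureTheory.volume a b :=
    ContinuousOn.intervalIntegrable (huIcc ▸ hwc)
  have hwle : ∀ x ∈ Set.Icc a b, |w x| ≤ 1 / μ := fun x hx => by
    rw [abs_inv, one_div]
    exact inv_anti₀ hμ (hφ x hx)
  have hint := intervalIntegral.integral_mul_deriv_eq_deriv_mul (a := a) (b := b)
    (u := fun x => (w x : ℂ)) (v := fun x => c * expTwoPi (φ x))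
    (u' := fun x => ((-φ₂ x / φ₁ x ^ 2 : ℝ) : ℂ))
    (v' := fun x => c * (2 * Real.pi * Complex.I * φ₁ x * expTwoPi (φ x)))
    (fun x hx => (hw x (huIcc ▸ hx)).ofReal_comp)
    (fun x _ => (hasDerivAt_expTwoPi_comp (h₁ x)).const_mul c)
    (ContinuousOn.intervalIntegrable (huIcc ▸ Complex.continuous_ofReal.comp_continuousOn hwc))
    (Continuous.intervalIntegrable (by have := continuous_expTwoPi; fun_prop) _ _)
  have heq : ∫ t in a..b, expTwoPi (φ t) =
      ∫ x in a..b, (w x : ℂ) * (c * (2 * Real.pi * Complex.I * φ₁ x * expTwoPi (φ x))) := by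
    refine intervalIntegral.integral_congr fun x hx => ?_
    have h0 : (φ₁ x : ℂ) ≠ 0 := by exact_mod_cast hne x (huIcc ▸ hx)
    simp only [w, hcdef]
    push_cast
    field_simp
  rw [heq, hint]
  have hbd : ∀ x ∈ Set.Icc a b, ‖(w x : ℂ) * (c * expTwoPi (φ x))‖ ≤ 1 / (2 * Real.pi) * (1 / μ) :=
    fun x hx => by
      rw [norm_mul, norm_mul, norm_expTwoPi, mul_one, hcnorm, Complex.norm_real, mul_comm,
        Real.norm_eq_abs]
      gcongr
      exact hwle x hx
  have hlast : ‖∫ x in a..b, ((-φ₂ x / φ₁ x ^ 2 : ℝ) : ℂ) * (c * expTwoPi (φ x))‖ ≤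
      1 / (2 * Real.pi) * (2 * (1 / μ)) := by
    have h1 : ‖∫ x in a..b, ((-φ₂ x / φ₁ x ^ 2 : ℝ) : ℂ) * (c * expTwoPi (φ x))‖ ≤
        ∫ x in a..b, 1 / (2 * Real.pi) * -(-φ₂ x / φ₁ x ^ 2) := by
      refine intervalIntegral.norm_integral_le_of_norm_le hab ?_ (hwi.neg.const_mul _)
      refine Filter.Eventually.of_forall fun x hx => ?_
      have hx' : x ∈ Set.Icc a b := Set.Ioc_subset_Icc_self hx
      rw [norm_mul, norm_mul, norm_expTwoPi, mul_one, hcnorm, Complex.norm_real, mul_comm,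
        Real.norm_eq_abs, abs_of_nonpos]
      exact div_nonpos_of_nonpos_of_nonneg (neg_nonpos.2 (hconv x hx')) (sq_nonneg _)
    refine h1.trans ?_
    rw [intervalIntegral.integral_const_mul, intervalIntegral.integral_neg,
      intervalIntegral.integral_eq_sub_of_hasDerivAt (fun x hx => hw x (huIcc ▸ hx)) hwi]
    gcongr
    have ha := abs_le.1 (hwle a (Set.left_mem_Icc.2 hab))
    have hb := abs_le.1 (hwle b (Set.right_mem_Icc.2 hab))
    linarith [ha.1, ha.2, hb.1, hb.2]
  have h3 := norm_sub_le ((w b : ℂ) * (c * expTwoPi (φ b)) - (w a : ℂ) * (c * expTwoPi (φ a)))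
    (∫ x in a..b, ((-φ₂ x / φ₁ x ^ 2 : ℝ) : ℂ) * (c * expTwoPi (φ x)))
  have h4 := norm_sub_le ((w b : ℂ) * (c * expTwoPi (φ b))) ((w a : ℂ) * (c * expTwoPi (φ a)))
  have ha := hbd a (Set.left_mem_Icc.2 hab)
  have hb := hbd b (Set.right_mem_Icc.2 hab)
  refine h3.trans ?_
  have h5 : 1 / (2 * Real.pi) * (4 * (1 / μ)) ≤ 1 / μ := by
    rw [← mul_assoc]
    refine mul_le_of_le_one_left (by positivity) ?_
    rw [one_div_mul_eq_div, div_le_one hpi]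
    linarith [Real.pi_gt_three]
  linarith

/-- A continuous monotone function splits an interval into a part where it is at most `c` and a part
where it is at least `c`. -/
theorem MonotoneOn.exists_split {g : ℝ → ℝ} {a b : ℝ} (hab : a ≤ b) (hg : MonotoneOn g (Set.Icc a b))
    (hc : ContinuousOn g (Set.Icc a b)) (c : ℝ) :
    ∃ p ∈ Set.Icc a b, (p = a ∨ ∀ x ∈ Set.Icc a p, g x ≤ c) ∧
      (p = b ∨ ∀ x ∈ Set.Icc p b, c ≤ g x) := by
  rcases le_total (g b) c with hb | hb
  · exact ⟨b, Set.right_mem_Icc.2 hab,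
      Or.inr fun x hx => (hg hx (Set.right_mem_Icc.2 hab) hx.2).trans hb, Or.inl rfl⟩
  rcases le_total c (g a) with ha | ha
  · exact ⟨a, Set.left_mem_Icc.2 hab, Or.inl rfl,
      Or.inr fun x hx => ha.trans (hg (Set.left_mem_Icc.2 hab) hx hx.1)⟩
  obtain ⟨p, hp, hpc⟩ := intermediate_value_Icc hab hc ⟨ha, hb⟩
  refine ⟨p, hp, Or.inr fun x hx => ?_, Or.inr fun x hx => ?_⟩
  · exact hpc ▸ hg ⟨hx.1, hx.2.trans hp.2⟩ hp hx.2
  · exact hpc ▸ hg hp ⟨hp.1.trans hx.1, hx.2⟩ hx.1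

theorem mul_sub_le_sub_of_le_deriv {g g' : ℝ → ℝ} (h : ∀ x, HasDerivAt g (g' x) x) {a b c : ℝ}
    (hab : a ≤ b) (hc : ∀ x ∈ Set.Icc a b, c ≤ g' x) : c * (b - a) ≤ g b - g a := by
  refine (convex_Icc a b).mul_sub_le_image_sub_of_le_deriv
    (fun x _ => (h x).continuousAt.continuousWithinAt)
    (fun x _ => (h x).differentiableAt.differentiableWithinAt) (fun x hx => ?_)
    a (Set.left_mem_Icc.2 hab) b (Set.right_mem_Icc.2 hab) hab
  rw [(h x).deriv]
  exact hc x (interior_subset hx)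

theorem monotoneOn_of_hasDerivAt_nonneg {g g' : ℝ → ℝ} (h : ∀ x, HasDerivAt g (g' x) x) {a b : ℝ}
    (hc : ∀ x ∈ Set.Icc a b, 0 ≤ g' x) : MonotoneOn g (Set.Icc a b) := fun x hx y hy hxy => by
  have := mul_sub_le_sub_of_le_deriv h hxy (c := 0) fun t ht => hc t ⟨hx.1.trans ht.1, ht.2.trans hy.2⟩
  linarith

/-- The second derivative test for oscillatory integrals. -/
theorem norm_integral_expTwoPi_le_of_le_deriv2 {φ φ₁ φ₂ : ℝ → ℝ}
    (h₁ : ∀ x, HasDerivAt φ (φ₁ x) x) (h₂ : ∀ x, HasDerivAt φ₁ (φ₂ x) x) (hc : Continuous φ₂)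
    {a b : ℝ} (hab : a ≤ b) {l : ℝ} (hl : 0 < l) (hφ : ∀ x ∈ Set.Icc a b, l ≤ φ₂ x) :
    ‖∫ t in a..b, expTwoPi (φ t)‖ ≤ 4 / √l := by
  set μ := √l with hμdef
  have hμ : 0 < μ := Real.sqrt_pos.2 hl
  have hμl : μ * μ = l := Real.mul_self_sqrt hl.le
  have hφc : Continuous φ := continuous_iff_continuousAt.2 fun x => (h₁ x).continuousAt
  have hφ₁c : Continuous φ₁ := continuous_iff_continuousAt.2 fun x => (h₂ x).continuousAt
  have hmono : MonotoneOn φ₁ (Set.Icc a b) :=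
    monotoneOn_of_hasDerivAt_nonneg h₂ fun x hx => hl.le.trans (hφ x hx)
  -- Cut where φ' crosses -√l and √l. The outer pieces fall to the first derivative test; on the
  -- middle piece φ' grows at rate at least l, so its length is at most 2/√l.
  obtain ⟨p, hp, hp1, hp2⟩ := hmono.exists_split hab hφ₁c.continuousOn (-μ)
  have hsub : Set.Icc p b ⊆ Set.Icc a b := Set.Icc_subset_Icc_left hp.1
  obtain ⟨r, hr, hr1, hr2⟩ := (hmono.mono hsub).exists_split hp.2 hφ₁c.continuousOn μ
  have hI := fun s t : ℝ => intervalIntegrable_expTwoPi hφc s t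
  rw [← intervalIntegral.integral_add_adjacent_intervals (hI a p) (hI p b),
    ← intervalIntegral.integral_add_adjacent_intervals (hI p r) (hI r b)]
  have hA : ‖∫ t in a..p, expTwoPi (φ t)‖ ≤ 1 / μ := by
    rcases hp1 with rfl | hp1
    · simp [hμ.le]
    · refine norm_integral_expTwoPi_le_of_le_abs_deriv h₁ h₂ hc hp.1
        (fun x hx => hl.le.trans (hφ x ⟨hx.1, hx.2.trans hp.2⟩)) hμ fun x hx => ?_
      have := hp1 x hx
      exact le_abs.2 (Or.inr (by linarith))
  have hC : ‖∫ t in r..b, expTwoPi (φ t)‖ ≤ 1 / μ := by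
    rcases hr2 with rfl | hr2
    · simp [hμ.le]
    · exact norm_integral_expTwoPi_le_of_le_abs_deriv h₁ h₂ hc hr.2
        (fun x hx => hl.le.trans (hφ x ⟨(hp.1.trans hr.1).trans hx.1, hx.2⟩)) hμ
        fun x hx => le_abs.2 (Or.inl (hr2 x hx))
  have hB : ‖∫ t in p..r, expTwoPi (φ t)‖ ≤ 2 / μ := by
    refine (norm_integral_expTwoPi_le_sub hr.1).trans ?_
    have hμ2 : 0 ≤ 2 / μ := by positivity
    rcases hr1 with rfl | hr1
    · simpa using hμ2
    rcases hp2 with rfl | hp2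
    · have : r = p := le_antisymm hr.2 hr.1
      simpa [this] using hμ2
    have h1 := mul_sub_le_sub_of_le_deriv h₂ hr.1 fun x hx =>
      hφ x ⟨hp.1.trans hx.1, hx.2.trans hr.2⟩
    have h2 := hr1 r (Set.right_mem_Icc.2 hr.1)
    have h3 := hp2 p (Set.left_mem_Icc.2 hp.2)
    rw [le_div_iff₀ hμ]
    rw [← hμl] at h1
    have h4 : μ * ((r - p) * μ) ≤ μ * 2 := by linarith
    exact le_of_mul_le_mul_left h4 hμ
  have e1 := norm_add_le (∫ t in a..p, expTwoPi (φ t))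
    ((∫ t in p..r, expTwoPi (φ t)) + ∫ t in r..b, expTwoPi (φ t))
  have e2 := norm_add_le (∫ t in p..r, expTwoPi (φ t)) (∫ t in r..b, expTwoPi (φ t))
  have e3 : 4 / μ = 1 / μ + 2 / μ + 1 / μ := by ring
  linarith

/-! ### Replacing a sum by an integral when |φ'| ≤ 1/2. -/

/-- The correction factor `1/(e(t)-1) - 1/(2πit)` is bounded and Lipschitz on `[-1/2, 1/2]`. -/
theorem exists_correction : ∃ (κ : ℝ → ℂ) (K : ℝ), 0 ≤ K ∧
    (∀ t ∈ Set.Icc (-1 / 2 : ℝ) (1 / 2), ‖κ t‖ ≤ K) ∧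
    (∀ s ∈ Set.Icc (-1 / 2 : ℝ) (1 / 2), ∀ t ∈ Set.Icc (-1 / 2 : ℝ) (1 / 2),
      ‖κ s - κ t‖ ≤ K * |s - t|) ∧
    ∀ t ∈ Set.Icc (-1 / 2 : ℝ) (1 / 2),
      1 - ∫ u in (0 : ℝ)..1, expTwoPi (t * u) = κ t * (expTwoPi t - 1) := by
  -- Here s(z) = (e^z - 1)/z and r(z) = (s(z) - 1)/z are entire, so κ = -r/s at z = 2πit is smooth
  -- wherever s does not vanish. On |t| ≤ 1/2 it has no zero, since e(t) = 1 forces t = 0 and s(0) =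
  -- 1.
  set s : ℂ → ℂ := dslope Complex.exp 0 with hs
  set r : ℂ → ℂ := dslope s 0 with hr
  have hsd : Differentiable ℂ s := by
    rw [← differentiableOn_univ]
    exact (Complex.differentiableOn_dslope Filter.univ_mem).2 Complex.differentiable_exp.differentiableOn
  have hrd : Differentiable ℂ r := by
    rw [← differentiableOn_univ]
    exact (Complex.differentiableOn_dslope Filter.univ_mem).2 hsd.differentiableOn
  have hs0 : s 0 = 1 := by rw [hs, dslope_same]; simp
  have hs1 : ∀ z, z * s z = Complex.exp z - 1 := fun z => by
    have := sub_smul_dslope Complex.exp 0 z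
    simpa using this
  have hr1 : ∀ z, z * r z = s z - 1 := fun z => by
    have := sub_smul_dslope s 0 z
    simpa [hs0] using this
  set ι : ℝ → ℂ := fun t => 2 * Real.pi * Complex.I * t with hι
  have hιc : ContDiff ℝ 1 ι := contDiff_const.mul Complex.ofRealCLM.contDiff
  have hsne : ∀ t ∈ Set.Icc (-1 / 2 : ℝ) (1 / 2), s (ι t) ≠ 0 := by
    intro t ht h0
    have h1 := hs1 (ι t)
    rw [h0, mul_zero] at h1
    have h2 : Complex.exp (ι t) = 1 := (sub_eq_zero.1 h1.symm)
    obtain ⟨n, hn⟩ := Complex.exp_eq_one_iff.1 h2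
    have h3 : (t : ℂ) = n := by
      have hpine : (2 * Real.pi * Complex.I : ℂ) ≠ 0 := by simp [Real.pi_ne_zero]
      refine mul_left_cancel₀ hpine ?_
      rw [mul_comm _ (n : ℂ)]
      exact hn
    have h4 : t = n := by exact_mod_cast h3
    have h5 : n = 0 := by
      have ha : (-1 : ℝ) < n := by linarith [ht.1]
      have hb : (n : ℝ) < 1 := by linarith [ht.2]
      have ha' : -1 < n := by exact_mod_cast ha
      have hb' : n < 1 := by exact_mod_cast hb
      omega
    rw [h4, h5, hι] at h0
    simp [hs0] at h0
  set κ : ℝ → ℂ := fun t => -r (ι t) / s (ι t) with hκ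
  have hκc : ContDiffOn ℝ 1 κ (Set.Icc (-1 / 2) (1 / 2)) := by
    simp only [hκ, div_eq_mul_inv]
    refine ContDiffOn.mul ?_ (ContDiffOn.inv ?_ hsne)
    · exact (((hrd.contDiff (n := 1)).restrict_scalars ℝ).comp hιc).neg.contDiffOn
    · exact (((hsd.contDiff (n := 1)).restrict_scalars ℝ).comp hιc).contDiffOn
  obtain ⟨L, hL⟩ := hκc.exists_lipschitzOnWith one_ne_zero (convex_Icc _ _) isCompact_Icc
  obtain ⟨M, hM⟩ := isCompact_Icc.exists_bound_of_continuousOn hκc.continuousOn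
  refine ⟨κ, max L M, le_max_of_le_left L.2, fun t ht => (hM t ht).trans (le_max_right _ _),
    fun x hx y hy => ?_, fun t ht => ?_⟩
  · have := hL.dist_le_mul x hx y hy
    rw [dist_eq_norm, Real.dist_eq] at this
    exact this.trans (by gcongr; exact le_max_left _ _)
  · have hint : ∫ u in (0 : ℝ)..1, expTwoPi (t * u) = s (ι t) := by
      by_cases h0 : t = 0
      · subst h0
        simp [hι, hs0, expTwoPi_zero]
      have hne : ι t ≠ 0 := by simp [hι, h0, Real.pi_ne_zero]
      have h1 : ∫ u in (0 : ℝ)..1, expTwoPi (t * u) = ∫ u in (0 : ℝ)..1, Complex.exp (ι t * u) := by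
        refine intervalIntegral.integral_congr fun u _ => ?_
        simp only [expTwoPi, hι]
        congr 1
        push_cast
        ring
      rw [h1, integral_exp_mul_complex hne]
      rw [div_eq_iff hne, mul_comm (s (ι t)), hs1]
      simp
    have he : expTwoPi t - 1 = ι t * s (ι t) := (hs1 (ι t)).symm
    rw [hint, he, hκ]
    have := hsne t ht
    field_simp
    linear_combination hr1 (ι t)

theorem sub_le_mul_sub_of_deriv_le {g g' : ℝ → ℝ} (h : ∀ x, HasDerivAt g (g' x) x) {a b c : ℝ}
    (hab : a ≤ b) (hc : ∀ x ∈ Set.Icc a b, g' x ≤ c) : g b - g a ≤ c * (b - a) := by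
  have := mul_sub_le_sub_of_le_deriv (fun x => (h x).neg) hab (c := -c)
    fun x hx => neg_le_neg (hc x hx)
  simp only [Pi.neg_apply] at this
  linarith

/-- For a phase linear on [n, n+1] with slope t, the defining identity of κ makes the difference of
term and integral exactly κ(t) times the increment of e(φ). A general φ is linearised there with an
error controlled by the variation of φ', so that both the corrected difference and the error
telescope over n. -/
theorem norm_unit_step_le {κ : ℝ → ℂ} {K : ℝ} (hK : 0 ≤ K)
    (hb : ∀ t ∈ Set.Icc (-1 / 2 : ℝ) (1 / 2), ‖κ t‖ ≤ K)
    (hlip : ∀ s ∈ Set.Icc (-1 / 2 : ℝ) (1 / 2), ∀ t ∈ Set.Icc (-1 / 2 : ℝ) (1 / 2),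
      ‖κ s - κ t‖ ≤ K * |s - t|)
    (hκ : ∀ t ∈ Set.Icc (-1 / 2 : ℝ) (1 / 2),
      1 - ∫ u in (0 : ℝ)..1, expTwoPi (t * u) = κ t * (expTwoPi t - 1))
    {φ φ₁ : ℝ → ℝ} (h₁ : ∀ x, HasDerivAt φ (φ₁ x) x) {n : ℝ}
    (hmono : MonotoneOn φ₁ (Set.Icc n (n + 1)))
    (hsm : ∀ x ∈ Set.Icc n (n + 1), |φ₁ x| ≤ 1 / 2) :
    ‖(expTwoPi (φ n) - ∫ x in n..(n + 1), expTwoPi (φ x)) -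
      (κ (φ₁ (n + 1)) * expTwoPi (φ (n + 1)) - κ (φ₁ n) * expTwoPi (φ n))‖ ≤
      (2 * Real.pi * (1 + K) + K) * (φ₁ (n + 1) - φ₁ n) := by
  have hn1 : n ≤ n + 1 := by linarith
  have hφc : Continuous φ := continuous_iff_continuousAt.2 fun x => (h₁ x).continuousAt
  have hmem : ∀ x ∈ Set.Icc n (n + 1), φ₁ x ∈ Set.Icc (-1 / 2 : ℝ) (1 / 2) := fun x hx => by
    have := abs_le.1 (hsm x hx)
    exact ⟨by linarith [this.1], this.2⟩
  have hl := Set.left_mem_Icc.2 hn1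
  have hr := Set.right_mem_Icc.2 hn1
  set t := φ₁ n with ht
  set V := φ₁ (n + 1) - t with hV
  have hV0 : 0 ≤ V := sub_nonneg.2 (hmono hl hr hn1)
  have hlin : ∀ u ∈ Set.Icc (0 : ℝ) 1, |φ (n + u) - (φ n + t * u)| ≤ V := by
    intro u hu
    have hnu : n ≤ n + u := by linarith [hu.1]
    have hsub : ∀ x ∈ Set.Icc n (n + u), x ∈ Set.Icc n (n + 1) := fun x hx =>
      ⟨hx.1, hx.2.trans (by linarith [hu.2])⟩
    have e1 := mul_sub_le_sub_of_le_deriv h₁ hnu (c := t) fun x hx => hmono hl (hsub x hx) hx.1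
    have e2 := sub_le_mul_sub_of_deriv_le h₁ hnu (c := φ₁ (n + 1)) fun x hx =>
      hmono (hsub x hx) hr (hsub x hx).2
    have e3 : V * u ≤ V := mul_le_of_le_one_right hV0 hu.2
    rw [abs_le]
    constructor <;> nlinarith
  set E := expTwoPi (φ n) with hE
  set E' := expTwoPi (φ (n + 1)) with hE'
  have hI : ‖E * (∫ u in (0 : ℝ)..1, expTwoPi (t * u)) - ∫ x in n..(n + 1), expTwoPi (φ x)‖ ≤
      2 * Real.pi * V := by
    have e1 : ∫ x in n..(n + 1), expTwoPi (φ x) = ∫ u in (0 : ℝ)..1, expTwoPi (φ (n + u)) := by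
      rw [intervalIntegral.integral_comp_add_left (fun x => expTwoPi (φ x)), add_zero]
    rw [e1, ← intervalIntegral.integral_const_mul, ← intervalIntegral.integral_sub]
    · have := intervalIntegral.norm_integral_le_of_norm_le_const (a := 0) (b := 1)
        (C := 2 * Real.pi * V)
        (f := fun u => E * expTwoPi (t * u) - expTwoPi (φ (n + u))) fun u hu => ?_
      · simpa using this
      rw [Set.uIoc_of_le zero_le_one] at hu
      rw [hE, ← expTwoPi_add]
      refine (norm_expTwoPi_sub_le _ _).trans ?_
      rw [abs_sub_comm]
      exact mul_le_mul_of_nonneg_left (hlin u ⟨hu.1.le, hu.2⟩) Real.two_pi_pos.le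
    · exact ((continuous_expTwoPi.comp (continuous_const.mul continuous_id)).const_mul
        E).intervalIntegrable _ _
    · exact intervalIntegrable_expTwoPi (by fun_prop) _ _
  have hS : ‖E * expTwoPi t - E'‖ ≤ 2 * Real.pi * V := by
    rw [hE, hE', ← expTwoPi_add]
    refine (norm_expTwoPi_sub_le _ _).trans ?_
    rw [abs_sub_comm]
    have := hlin 1 (by norm_num)
    rw [mul_one] at this
    exact mul_le_mul_of_nonneg_left this Real.two_pi_pos.le
  have hid : (E - ∫ x in n..(n + 1), expTwoPi (φ x)) - (κ (φ₁ (n + 1)) * E' - κ t * E) =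
      (E * (∫ u in (0 : ℝ)..1, expTwoPi (t * u)) - ∫ x in n..(n + 1), expTwoPi (φ x)) +
      κ t * (E * expTwoPi t - E') - (κ (φ₁ (n + 1)) - κ t) * E' := by
    have := hκ t (hmem n hl)
    linear_combination E * this
  rw [hid]
  refine (norm_sub_le _ _).trans ((add_le_add_left (norm_add_le _ _) _).trans ?_)
  rw [norm_mul, norm_mul, norm_expTwoPi, mul_one]
  have e1 := hlip _ (hmem _ hr) _ (hmem _ hl)
  rw [abs_of_nonneg hV0] at e1
  have e2 : ‖κ t‖ * ‖E * expTwoPi t - E'‖ ≤ K * (2 * Real.pi * V) :=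
    mul_le_mul (hb t (hmem n hl)) hS (norm_nonneg _) hK
  calc _ ≤ 2 * Real.pi * V + K * (2 * Real.pi * V) + K * V := add_le_add (add_le_add hI e2) e1
    _ = _ := by ring

/-- Comparison of an exponential sum with an integral when the derivative of the phase is monotone
and at most `1/2` in absolute value. -/
theorem exists_norm_sum_sub_integral_le : ∃ K : ℝ, 0 < K ∧ ∀ φ φ₁ : ℝ → ℝ,
    (∀ x, HasDerivAt φ (φ₁ x) x) → ∀ M N : ℕ, M ≤ N → MonotoneOn φ₁ (Set.Icc M N) →
    (∀ x ∈ Set.Icc (M : ℝ) N, |φ₁ x| ≤ 1 / 2) →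
    ‖∑ n ∈ Finset.Ico M N, expTwoPi (φ n) - ∫ x in (M : ℝ)..N, expTwoPi (φ x)‖ ≤ K := by
  obtain ⟨κ, K, hK, hb, hlip, hκ⟩ := exists_correction
  have hpi := Real.two_pi_pos
  set A := 2 * Real.pi * (1 + K) + K with hA
  have hA0 : 0 < A := by positivity
  refine ⟨A + 2 * K, by positivity, fun φ φ₁ h₁ M N hMN hmono hsm => ?_⟩
  have hφc : Continuous φ := continuous_iff_continuousAt.2 fun x => (h₁ x).continuousAt
  have key : ∀ L, M ≤ L → L ≤ N →
      ‖(∑ n ∈ Finset.Ico M L, expTwoPi (φ n) - ∫ x in (M : ℝ)..L, expTwoPi (φ x)) -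
        (κ (φ₁ L) * expTwoPi (φ L) - κ (φ₁ M) * expTwoPi (φ M))‖ ≤ A * (φ₁ L - φ₁ M) := by
    intro L hML
    induction L, hML using Nat.le_induction with
    | base => intro _; simp
    | succ L hML ih =>
      intro hLN
      have hsub : Set.Icc (L : ℝ) (L + 1) ⊆ Set.Icc (M : ℝ) N := Set.Icc_subset_Icc
        (by exact_mod_cast hML) (by exact_mod_cast hLN)
      have e1 := ih (by omega)
      have e2 := norm_unit_step_le hK hb hlip hκ h₁ (hmono.mono hsub) fun x hx => hsm x (hsub hx)
      rw [Finset.sum_Ico_succ_top hML, Nat.cast_succ,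
        ← intervalIntegral.integral_add_adjacent_intervals
          (intervalIntegrable_expTwoPi hφc M L) (intervalIntegrable_expTwoPi hφc L (L + 1))]
      have e3 := norm_add_le_of_le e1 e2
      calc _ = _ := by congr 1; ring
        _ ≤ _ := e3
        _ = _ := by rw [hA]; ring
  have e1 := key N hMN le_rfl
  have hMm : (M : ℝ) ∈ Set.Icc (M : ℝ) N := ⟨le_rfl, by exact_mod_cast hMN⟩
  have hNm : (N : ℝ) ∈ Set.Icc (M : ℝ) N := ⟨by exact_mod_cast hMN, le_rfl⟩
  have hM := abs_le.1 (hsm M hMm)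
  have hN := abs_le.1 (hsm N hNm)
  -- The accumulated errors amount to the total variation of φ', at most 1 because |φ'| ≤ 1/2.
  have e2 : A * (φ₁ N - φ₁ M) ≤ A := mul_le_of_le_one_right hA0.le (by linarith [hM.1, hN.2])
  have e3 : ‖κ (φ₁ N) * expTwoPi (φ N) - κ (φ₁ M) * expTwoPi (φ M)‖ ≤ 2 * K := by
    refine (norm_sub_le _ _).trans ?_
    rw [norm_mul, norm_mul, norm_expTwoPi, norm_expTwoPi, mul_one, mul_one]
    have := hb (φ₁ N) ⟨by linarith [hN.1], hN.2⟩
    have := hb (φ₁ M) ⟨by linarith [hM.1], hM.2⟩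
    linarith
  have e4 := norm_add_le_of_le (e1.trans e2) e3
  rwa [sub_add_cancel] at e4

/-! ### Van der Corput's method for convex phases. -/

/-- A phase on `[0, ∞)` with nonnegative, nondecreasing derivative `G₁` satisfying
`G₁ x ≤ x * G₁' x`. -/
structure IsConvexPhase (G G₁ G₂ : ℝ → ℝ) : Prop where
  deriv₁ : ∀ x, HasDerivAt G (G₁ x) x
  deriv₂ : ∀ x, HasDerivAt G₁ (G₂ x) x
  cont : Continuous G₂
  nonneg₁ : ∀ x, 0 ≤ x → 0 ≤ G₁ x
  nonneg₂ : ∀ x, 0 ≤ x → 0 ≤ G₂ x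
  le_mul : ∀ x, 0 ≤ x → G₁ x ≤ x * G₂ x

namespace IsConvexPhase

variable {G G₁ G₂ : ℝ → ℝ}

theorem monotoneOn (hG : IsConvexPhase G G₁ G₂) : MonotoneOn G₁ (Set.Ici 0) := fun x hx y _ hxy => by
  have hx0 : (0 : ℝ) ≤ x := hx
  exact monotoneOn_of_hasDerivAt_nonneg hG.deriv₂ (a := x) (b := y)
    (fun t ht => hG.nonneg₂ t (hx0.trans ht.1)) (Set.left_mem_Icc.2 hxy) (Set.right_mem_Icc.2 hxy) hxy

theorem mono (hG : IsConvexPhase G G₁ G₂) {x y : ℝ} (hx : 0 ≤ x) (hxy : x ≤ y) : G₁ x ≤ G₁ y :=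
  hG.monotoneOn hx (hx.trans hxy) hxy

theorem continuous (hG : IsConvexPhase G G₁ G₂) : Continuous G :=
  continuous_iff_continuousAt.2 fun x => (hG.deriv₁ x).continuousAt

theorem continuous₁ (hG : IsConvexPhase G G₁ G₂) : Continuous G₁ :=
  continuous_iff_continuousAt.2 fun x => (hG.deriv₂ x).continuousAt

theorem hasDerivAt_sub_mul (hG : IsConvexPhase G G₁ G₂) (s x : ℝ) :
    HasDerivAt (fun x => G x - s * x) (G₁ x - s) x := by
  simpa only [mul_one] using! (hG.deriv₁ x).sub ((hasDerivAt_id x).const_mul s)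

theorem norm_integral_le_of_le_abs (hG : IsConvexPhase G G₁ G₂) {A B s μ : ℝ} (hA : 0 ≤ A)
    (hAB : A ≤ B) (hμ : 0 < μ) (h : ∀ x ∈ Set.Icc A B, μ ≤ |G₁ x - s|) :
    ‖∫ x in A..B, expTwoPi (G x - s * x)‖ ≤ 1 / μ :=
  norm_integral_expTwoPi_le_of_le_abs_deriv (hG.hasDerivAt_sub_mul s)
    (fun x => (hG.deriv₂ x).sub_const s) hG.cont hAB (fun x hx => hG.nonneg₂ x (hA.trans hx.1)) hμ h

/-- From G₁ ≤ xG₂ one gets G₂ ≥ c/X on the whole interval, and the linear term sx does not affect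
the second derivative test. -/
theorem norm_integral_le_of_le (hG : IsConvexPhase G G₁ G₂) {A B X s c : ℝ} (hA : 0 ≤ A)
    (hAB : A ≤ B) (hBX : B ≤ X) (hc : 0 < c) (h : c ≤ G₁ A) :
    ‖∫ x in A..B, expTwoPi (G x - s * x)‖ ≤ 4 * √(X / c) := by
  have hA0 : 0 < A := by
    rcases hA.lt_or_eq with h0 | h0
    · exact h0
    · have := hG.le_mul A hA
      rw [← h0] at this h
      linarith
  have hX : 0 < X := by linarith
  have := norm_integral_expTwoPi_le_of_le_deriv2 (hG.hasDerivAt_sub_mul s)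
    (fun x => (hG.deriv₂ x).sub_const s) hG.cont hAB (l := c / X) (by positivity) fun x hx => ?_
  · rwa [div_eq_mul_inv, ← Real.sqrt_inv, inv_div] at this
  · have hx0 : 0 ≤ x := hA.trans hx.1
    have h1 : G₁ A ≤ G₁ x := hG.monotoneOn hA hx0 hx.1
    have h2 := hG.le_mul x hx0
    have h3 : x * G₂ x ≤ X * G₂ x :=
      mul_le_mul_of_nonneg_right (hx.2.trans hBX) (hG.nonneg₂ x hx0)
    rw [div_le_iff₀ hX]
    linarith

end IsConvexPhase

theorem Monotone.exists_threshold {g : ℕ → ℝ} (hg : Monotone g) (N : ℕ) (c : ℝ) :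
    ∃ k ≤ N, ∀ n < N, n < k ↔ g n < c := by
  induction N with
  | zero => exact ⟨0, le_rfl, by simp⟩
  | succ N ih =>
    obtain ⟨k, hk, h⟩ := ih
    by_cases hN : g N < c
    · exact ⟨N + 1, le_rfl, fun n hn =>
        ⟨fun _ => (hg (Nat.lt_succ_iff.1 hn)).trans_lt hN, fun _ => hn⟩⟩
    · refine ⟨k, hk.trans (Nat.le_succ N), fun n hn => ?_⟩
      rcases Nat.lt_succ_iff_lt_or_eq.1 hn with hn | rfl
      · exact h n hn
      · exact ⟨fun h' => absurd h' (not_lt.2 hk), fun h' => absurd h' hN⟩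

theorem Finset.sum_range_sum_Ico {M : Type*} [AddCommMonoid M] {k : ℕ → ℕ} (hk : Monotone k)
    (F : ℕ → M) (J : ℕ) :
    ∑ j ∈ Finset.range J, ∑ n ∈ Finset.Ico (k j) (k (j + 1)), F n =
      ∑ n ∈ Finset.Ico (k 0) (k J), F n := by
  induction J with
  | zero => simp
  | succ J ih =>
    rw [Finset.sum_range_succ, ih,
      Finset.sum_Ico_consecutive _ (hk (Nat.zero_le J)) (hk (Nat.le_succ J))]

theorem sum_inv_sqrt_le (n : ℕ) : ∑ h ∈ Finset.range n, 1 / √((h : ℝ) + 1) ≤ 2 * √n := by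
  induction n with
  | zero => simp
  | succ n ih =>
    rw [Finset.sum_range_succ, Nat.cast_succ]
    have h1 : 0 < √((n : ℝ) + 1) := Real.sqrt_pos.2 (by positivity)
    have h2 : √((n : ℝ) + 1) * √((n : ℝ) + 1) = n + 1 := Real.mul_self_sqrt (by positivity)
    have h3 : √(n : ℝ) * √(n : ℝ) = n := Real.mul_self_sqrt (by positivity)
    have h4 : 1 / √((n : ℝ) + 1) ≤ 2 * √((n : ℝ) + 1) - 2 * √n := by
      rw [div_le_iff₀ h1]
      nlinarith [sq_nonneg (√((n : ℝ) + 1) - √n)]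
    linarith

/-- The sum over a block on which `G₁ - θ` is within `1/2` of the integer `h`. -/
theorem exists_norm_block_sub_integral_le : ∃ K : ℝ, 0 < K ∧ ∀ G G₁ G₂ : ℝ → ℝ,
    IsConvexPhase G G₁ G₂ → ∀ (θ : ℝ) (h : ℤ) (M L : ℕ), M < L →
    (∀ n ∈ Set.Ico M L, |G₁ n - (θ + h)| ≤ 1 / 2) →
    ‖∑ n ∈ Finset.Ico M L, expTwoPi (G n - θ * n) -
      ∫ x in (M : ℝ)..((L - 1 : ℕ) : ℝ), expTwoPi (G x - (θ + h) * x)‖ ≤ K := by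
  obtain ⟨K, hK, hmain⟩ := exists_norm_sum_sub_integral_le
  refine ⟨K + 1, by linarith, fun G G₁ G₂ hG θ h M L hML hG₁ => ?_⟩
  -- The condition on G₁ is known only up to the last integer of the block. The comparison stops
  -- there, and the last term of the sum costs 1.
  obtain ⟨L, rfl⟩ : ∃ L', L = L' + 1 := ⟨L - 1, by omega⟩
  have hML' : M ≤ L := Nat.lt_succ_iff.1 hML
  have hMLR : (M : ℝ) ≤ L := by exact_mod_cast hML'
  have hM0 : (0 : ℝ) ≤ M := Nat.cast_nonneg M
  have e1 := hmain (fun x => G x - (θ + h) * x) (fun x => G₁ x - (θ + h))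
    (hG.hasDerivAt_sub_mul (θ + h)) M L hML'
    (fun x hx y hy hxy => sub_le_sub_right
      (hG.monotoneOn (hM0.trans hx.1) (hM0.trans hy.1) hxy) _)
    (fun x hx => by
      have l1 := abs_le.1 (hG₁ M ⟨le_rfl, hML⟩)
      have l2 := abs_le.1 (hG₁ L ⟨hML', Nat.lt_succ_self L⟩)
      have l3 := hG.monotoneOn hM0 (hM0.trans hx.1) hx.1
      have l4 := hG.monotoneOn (hM0.trans hx.1) (hM0.trans hMLR) hx.2
      exact abs_le.2 ⟨by linarith [l1.1], by linarith [l2.2]⟩)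
  have e2 : ∀ n : ℕ, expTwoPi (G n - θ * n) = expTwoPi (G n - (θ + h) * n) := fun n => by
    have : G n - θ * n = (G n - (θ + h) * n) + ((h * n : ℤ) : ℝ) := by push_cast; ring
    rw [this, expTwoPi_add, expTwoPi_intCast, mul_one]
  rw [Finset.sum_Ico_succ_top hML', Nat.add_sub_cancel, add_sub_right_comm]
  refine norm_add_le_of_le ?_ (norm_expTwoPi _).le
  simp only [e2]
  exact e1

/-- Splitting `∑ e(G n - θ n)` according to the nearest integer to `G₁ n - θ`. -/
theorem exists_norm_sum_le_blocks : ∃ K : ℝ, 0 < K ∧ ∀ G G₁ G₂ : ℝ → ℝ,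
    IsConvexPhase G G₁ G₂ → ∀ (X θ : ℝ), 0 ≤ X → 0 ≤ θ → θ < 1 →
    ∃ k₁ k₂ : ℕ, k₁ ≤ k₂ ∧ k₂ ≤ ⌊X⌋₊ ∧
      (∀ n < ⌊X⌋₊, n < k₁ ↔ G₁ n < θ - 1 / 2) ∧ (∀ n < ⌊X⌋₊, n < k₂ ↔ G₁ n < θ + 1 / 2) ∧
      ‖∑ n ∈ Finset.range ⌊X⌋₊, expTwoPi (G n - θ * n) -
        ∑ n ∈ Finset.Ico k₁ k₂, expTwoPi (G n - θ * n)‖ ≤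
        K * (1 + G₁ X + √(X * G₁ X) + 1 / (1 - θ)) := by
  obtain ⟨K, hK, hblock⟩ := exists_norm_block_sub_integral_le
  refine ⟨2 * K + 16, by linarith, fun G G₁ G₂ hG X θ hX hθ0 hθ1 => ?_⟩
  set N := ⌊X⌋₊ with hN
  set H := G₁ X with hH
  have hH0 : 0 ≤ H := hG.nonneg₁ X hX
  have hNX : (N : ℝ) ≤ X := Nat.floor_le hX
  have hmono : Monotone fun n : ℕ => G₁ n := fun a b hab =>
    hG.mono (Nat.cast_nonneg a) (by exact_mod_cast hab)
  have hle : ∀ n < N, G₁ n ≤ H := fun n hn =>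
    hG.mono (Nat.cast_nonneg n) (le_trans (by exact_mod_cast hn.le) hNX)
  -- The block from `k j` to `k (j + 1)` consists of those n for which G₁ n - θ is within 1/2 of the
  -- integer j - 1.
  choose k hkN hk using fun j : ℕ => hmono.exists_threshold N (θ + j - 3 / 2)
  have hkmono : Monotone k := by
    refine monotone_nat_of_le_succ fun j => ?_
    by_contra! hlt
    have hn : k (j + 1) < N := hlt.trans_le (hkN j)
    have h1 := (hk j _ hn).1 hlt
    have h2 := (hk (j + 1) _ hn).2 (by push_cast; linarith)
    exact lt_irrefl _ h2
  have hk0 : k 0 = 0 := by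
    by_contra! h0
    have h1 : 0 < k 0 := Nat.pos_of_ne_zero h0
    have h2 := (hk 0 0 (h1.trans_le (hkN 0))).1 h1
    have h3 := hG.nonneg₁ ((0 : ℕ) : ℝ) (Nat.cast_nonneg _)
    rw [Nat.cast_zero] at h2 h3
    linarith
  -- The integers h ≥ 1 needed are h = 1, …, P. Having P ≤ 2H, so that P = 0 for H < 1/2, keeps the
  -- total at √(XH) rather than √(X(1+H)).
  set P := ⌊2 * H⌋₊ with hP
  have hPle : (P : ℝ) ≤ 2 * H := Nat.floor_le (by linarith)
  have hkP : k (P + 2) = N := by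
    refine le_antisymm (hkN _) ?_
    by_contra! hlt
    have h1 := mt (hk (P + 2) _ hlt).2 (lt_irrefl _)
    have h2 := hle _ hlt
    have h3 : 2 * H < P + 1 := Nat.lt_floor_add_one _
    have h4 : (0 : ℝ) ≤ P := Nat.cast_nonneg P
    push_cast at h1
    rcases lt_or_ge H (1 / 2) with h5 | h5 <;> linarith
  refine ⟨k 1, k 2, hkmono (by norm_num), hkN 2, fun n hn => ?_, fun n hn => ?_, ?_⟩
  · rw [hk 1 n hn]; push_cast
    rw [show θ + 1 - 3 / 2 = θ - 1 / 2 by ring]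
  · rw [hk 2 n hn]; push_cast
    rw [show θ + 2 - 3 / 2 = θ + 1 / 2 by ring]
  have hsplit := Finset.sum_range_sum_Ico hkmono (fun n : ℕ => expTwoPi (G n - θ * n)) (P + 2)
  rw [hk0, hkP, ← Finset.range_eq_Ico, Finset.sum_range_succ', Finset.sum_range_succ',
    hk0] at hsplit
  have hrew : ∑ n ∈ Finset.range N, expTwoPi (G n - θ * n) -
      ∑ n ∈ Finset.Ico (k 1) (k 2), expTwoPi (G n - θ * n) =
      (∑ i ∈ Finset.range P, ∑ n ∈ Finset.Ico (k (i + 1 + 1)) (k (i + 1 + 1 + 1)),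
        expTwoPi (G n - θ * n)) + ∑ n ∈ Finset.Ico 0 (k 1), expTwoPi (G n - θ * n) := by
    rw [← hsplit]
    ring
  have hwin : ∀ j n, n ∈ Set.Ico (k j) (k (j + 1)) → |G₁ n - (θ + ((j - 1 : ℤ) : ℝ))| ≤ 1 / 2 := by
    intro j n hn
    have hnN : n < N := hn.2.trans_le (hkN _)
    have h1 := (hk (j + 1) n hnN).1 hn.2
    have h2 := mt (hk j n hnN).2 (not_lt.2 hn.1)
    push_cast at h1 h2 ⊢
    exact abs_le.2 ⟨by linarith, by linarith⟩
  have hθ' : 0 < 1 - θ := by linarith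
  -- This is the block h = -1: since G₁ ≥ 0, the shifted derivative is at least 1 - θ.
  have hfirst : ‖∑ n ∈ Finset.Ico 0 (k 1), expTwoPi (G n - θ * n)‖ ≤ K + 1 / (1 - θ) := by
    rcases Nat.eq_zero_or_pos (k 1) with h0 | h0
    · rw [h0]; simp; positivity
    have e1 := hblock G G₁ G₂ hG θ (-1) 0 (k 1) h0 fun n hn => by
      have := hwin 0 n (by rw [hk0]; exact hn)
      simpa using this
    have e2 := hG.norm_integral_le_of_le_abs (A := ((0 : ℕ) : ℝ)) (B := ((k 1 - 1 : ℕ) : ℝ))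
      (s := θ + ((-1 : ℤ) : ℝ)) (μ := 1 - θ) (by simp) (by simp) hθ' fun x hx => by
        have := hG.nonneg₁ x (by simpa using hx.1)
        push_cast
        exact le_abs.2 (Or.inl (by linarith))
    have := norm_add_le_of_le e1 e2
    rwa [sub_add_cancel] at this
  -- This is the block h = i + 1: there G₁ ≥ θ + i + 1/2 ≥ (i + 1)/2, the constant c in the second
  -- derivative test.
  have hrest : ∀ i ∈ Finset.range P, ‖∑ n ∈ Finset.Ico (k (i + 1 + 1)) (k (i + 1 + 1 + 1)),
      expTwoPi (G n - θ * n)‖ ≤ K + 4 * √(2 * X) * (1 / √((i : ℝ) + 1)) := by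
    intro i _
    have hle' : k (i + 1 + 1) ≤ k (i + 1 + 1 + 1) := hkmono (Nat.le_succ _)
    rcases hle'.eq_or_lt with h0 | h0
    · rw [← h0]; simp; positivity
    have e1 := hblock G G₁ G₂ hG θ _ _ _ h0 (hwin (i + 1 + 1))
    have hi : (0 : ℝ) ≤ i := Nat.cast_nonneg i
    have hkL : k (i + 1 + 1) < N := h0.trans_le (hkN _)
    have e2 := hG.norm_integral_le_of_le (A := (k (i + 1 + 1) : ℝ))
      (B := ((k (i + 1 + 1 + 1) - 1 : ℕ) : ℝ)) (X := X) (c := ((i : ℝ) + 1) / 2)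
      (s := θ + ((((i + 1 + 1 : ℕ) : ℤ) - 1 : ℤ) : ℝ))
      (Nat.cast_nonneg _) (by exact_mod_cast (by omega))
      (le_trans (by exact_mod_cast (Nat.sub_le _ _).trans (hkN _)) hNX) (by positivity) (by
        have := mt (hk (i + 1 + 1) _ hkL).2 (lt_irrefl _)
        push_cast at this
        linarith)
    have e3 : √(X / (((i : ℝ) + 1) / 2)) = √(2 * X) * (1 / √((i : ℝ) + 1)) := by
      rw [← Real.sqrt_one, ← Real.sqrt_div zero_le_one, Real.sqrt_one,
        ← Real.sqrt_mul (by positivity)]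
      congr 1
      field_simp
    rw [e3, ← mul_assoc] at e2
    have := norm_add_le_of_le e1 e2
    rwa [sub_add_cancel] at this
  rw [hrew]
  have e1 := norm_add_le_of_le (norm_sum_le_of_le _ hrest) hfirst
  refine e1.trans ?_
  rw [Finset.sum_add_distrib, ← Finset.mul_sum, Finset.sum_const, Finset.card_range, nsmul_eq_mul]
  have e4 : 4 * √(2 * X) * ∑ i ∈ Finset.range P, 1 / √((i : ℝ) + 1) ≤ 16 * √(X * H) := by
    calc 4 * √(2 * X) * ∑ i ∈ Finset.range P, 1 / √((i : ℝ) + 1)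
        ≤ 4 * √(2 * X) * (2 * √(2 * H)) := by
          gcongr
          exact (sum_inv_sqrt_le P).trans (by gcongr)
      _ = 8 * √(2 ^ 2 * (X * H)) := by
          rw [show (2 : ℝ) ^ 2 * (X * H) = (2 * X) * (2 * H) by ring,
            Real.sqrt_mul (show 0 ≤ 2 * X by positivity)]
          ring
      _ = 16 * √(X * H) := by
          rw [Real.sqrt_mul (by positivity), Real.sqrt_sq (by norm_num)]
          ring
  have e5 : (P : ℝ) * K ≤ 2 * H * K := by gcongr
  have e6 : 0 ≤ √(X * H) := Real.sqrt_nonneg _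
  have e7 : 0 ≤ 1 / (1 - θ) := by positivity
  have e8 : 0 ≤ K * √(X * H) := by positivity
  have e9 : 0 ≤ K * (1 / (1 - θ)) := by positivity
  nlinarith

/-- For θ = 0 the central block starts at 0 and yields the integral. If it stops before ⌊X⌋, then G₁
≥ 1/2 beyond it and the first derivative test bounds the remaining integral; otherwise that integral
has length below 1. -/
theorem exists_norm_sum_sub_integral_zero_le : ∃ K : ℝ, 0 < K ∧ ∀ G G₁ G₂ : ℝ → ℝ,
    IsConvexPhase G G₁ G₂ → ∀ X : ℝ, 0 ≤ X →
      ‖∑ n ∈ Finset.range ⌊X⌋₊, expTwoPi (G n) - ∫ x in (0 : ℝ)..X, expTwoPi (G x)‖ ≤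
        K * (1 + G₁ X + √(X * G₁ X)) := by
  obtain ⟨K, hK, hblocks⟩ := exists_norm_sum_le_blocks
  obtain ⟨K', hK', hblock⟩ := exists_norm_block_sub_integral_le
  refine ⟨2 * K + K' + 3, by linarith, fun G G₁ G₂ hG X hX => ?_⟩
  obtain ⟨k₁, L, hk, hLN, hk₁, hL, hmain⟩ := hblocks G G₁ G₂ hG X 0 hX le_rfl one_pos
  set N := ⌊X⌋₊ with hN
  have hNX : (N : ℝ) ≤ X := Nat.floor_le hX
  have hH0 : 0 ≤ G₁ X := hG.nonneg₁ X hX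
  have hk₁0 : k₁ = 0 := by
    by_contra! h0
    have h1 : 0 < k₁ := Nat.pos_of_ne_zero h0
    have h2 := (hk₁ 0 (h1.trans_le (hk.trans hLN))).1 h1
    have h3 := hG.nonneg₁ ((0 : ℕ) : ℝ) (Nat.cast_nonneg _)
    exact absurd (h3.trans_lt h2) (by norm_num)
  subst hk₁0
  simp only [zero_mul, sub_zero] at hmain
  have hI := fun a b : ℝ => intervalIntegrable_expTwoPi hG.continuous a b
  have hLX : (L : ℝ) ≤ X := le_trans (by exact_mod_cast hLN) hNX
  have hbl : ‖∑ n ∈ Finset.Ico 0 L, expTwoPi (G n) - ∫ x in (0 : ℝ)..L, expTwoPi (G x)‖ ≤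
      K' + 1 := by
    rcases Nat.eq_zero_or_pos L with h0 | h0
    · rw [h0]; simp; positivity
    have e1 := hblock G G₁ G₂ hG 0 0 0 L h0 fun n hn => by
      have h1 := (hL n (hn.2.trans_le hLN)).1 hn.2
      have h2 := hG.nonneg₁ _ (Nat.cast_nonneg n)
      simp only [Int.cast_zero, add_zero, sub_zero]
      exact abs_le.2 ⟨by linarith, by linarith⟩
    simp only [Int.cast_zero, add_zero, sub_zero, zero_mul, Nat.cast_zero] at e1
    have e2 : ‖∫ x in ((L - 1 : ℕ) : ℝ)..L, expTwoPi (G x)‖ ≤ 1 := by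
      refine (norm_integral_expTwoPi_le_sub (by exact_mod_cast Nat.sub_le _ _)).trans ?_
      rw [Nat.cast_sub h0]
      simp
    rw [← intervalIntegral.integral_add_adjacent_intervals (hI 0 ((L - 1 : ℕ) : ℝ)) (hI _ L),
      ← sub_sub]
    exact norm_sub_le_of_le e1 e2
  have htail : ‖∫ x in (L : ℝ)..X, expTwoPi (G x)‖ ≤ 2 := by
    rcases hLN.eq_or_lt with h0 | h0
    · refine (norm_integral_expTwoPi_le_sub hLX).trans ?_
      have := Nat.lt_floor_add_one X
      rw [h0]
      linarith
    · have h1 := mt (hL L h0).2 (lt_irrefl _)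
      have := hG.norm_integral_le_of_le_abs (A := L) (B := X) (s := 0) (μ := 1 / 2)
        (Nat.cast_nonneg L) hLX (by norm_num) fun x hx => by
          have := hG.mono (Nat.cast_nonneg L) hx.1
          exact le_abs.2 (Or.inl (by linarith))
      simp only [zero_mul, sub_zero] at this
      exact this.trans (by norm_num)
  have hid : ∑ n ∈ Finset.range N, expTwoPi (G n) - ∫ x in (0 : ℝ)..X, expTwoPi (G x) =
      (∑ n ∈ Finset.range N, expTwoPi (G n) - ∑ n ∈ Finset.Ico 0 L, expTwoPi (G n)) +
      (∑ n ∈ Finset.Ico 0 L, expTwoPi (G n) - ∫ x in (0 : ℝ)..L, expTwoPi (G x)) -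
      ∫ x in (L : ℝ)..X, expTwoPi (G x) := by
    rw [← intervalIntegral.integral_add_adjacent_intervals (hI 0 L) (hI L X)]
    ring
  rw [hid]
  refine (norm_sub_le_of_le (norm_add_le_of_le hmain hbl) htail).trans ?_
  have e6 : 0 ≤ √(X * G₁ X) := Real.sqrt_nonneg _
  nlinarith [mul_nonneg hK.le hH0, mul_nonneg hK.le e6, mul_nonneg hK'.le hH0, mul_nonneg hK'.le e6]

/-- The central block may contain a stationary point G₁ = θ. Cut it at G₁ = θ/2: the first
derivative test below gives 2/θ, the second derivative test above gives √(X/θ). The upper part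
matters only if G₁ reaches θ/2, hence the conditional term. -/
theorem exists_norm_sum_le_of_pos : ∃ K : ℝ, 0 < K ∧ ∀ G G₁ G₂ : ℝ → ℝ,
    IsConvexPhase G G₁ G₂ → ∀ X θ : ℝ, 0 ≤ X → 0 < θ → θ < 1 →
      ‖∑ n ∈ Finset.range ⌊X⌋₊, expTwoPi (G n - θ * n)‖ ≤
        K * (1 + G₁ X + √(X * G₁ X) + 1 / θ + 1 / (1 - θ) +
          if θ ≤ 2 * G₁ X then √(X / θ) else 0) := by
  obtain ⟨K, hK, hblocks⟩ := exists_norm_sum_le_blocks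
  obtain ⟨K', hK', hblock⟩ := exists_norm_block_sub_integral_le
  refine ⟨K + K' + 8, by linarith, fun G G₁ G₂ hG X θ hX hθ hθ1 => ?_⟩
  obtain ⟨M, L, hML, hLN, hM, hL, hmain⟩ := hblocks G G₁ G₂ hG X θ hX hθ.le hθ1
  set N := ⌊X⌋₊ with hN
  have hNX : (N : ℝ) ≤ X := Nat.floor_le hX
  have hH0 : 0 ≤ G₁ X := hG.nonneg₁ X hX
  set W := if θ ≤ 2 * G₁ X then √(X / θ) else 0 with hW
  have hW0 : 0 ≤ W := by rw [hW]; split_ifs <;> positivity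
  have hθ' : 0 < 1 / θ := by positivity
  have hbl : ‖∑ n ∈ Finset.Ico M L, expTwoPi (G n - θ * n)‖ ≤ K' + (2 * (1 / θ) + 8 * W) := by
    rcases hML.eq_or_lt with h0 | h0
    · rw [h0]; simp; positivity
    have e1 := hblock G G₁ G₂ hG θ 0 M L h0 fun n hn => by
      have hnN := hn.2.trans_le hLN
      have h1 := (hL n hnN).1 hn.2
      have h2 := mt (hM n hnN).2 (not_lt.2 hn.1)
      simp only [Int.cast_zero, add_zero]
      exact abs_le.2 ⟨by linarith, by linarith⟩
    simp only [Int.cast_zero, add_zero] at e1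
    have hM0 : (0 : ℝ) ≤ M := Nat.cast_nonneg M
    have hML' : (M : ℝ) ≤ ((L - 1 : ℕ) : ℝ) := by exact_mod_cast (by omega)
    have hLX : ((L - 1 : ℕ) : ℝ) ≤ X :=
      le_trans (by exact_mod_cast (Nat.sub_le _ _).trans hLN) hNX
    obtain ⟨p, hp, hp1, hp2⟩ := (hG.monotoneOn.mono (fun x hx => hM0.trans hx.1)).exists_split hML'
      hG.continuous₁.continuousOn (θ / 2)
    have hI := fun a b : ℝ => intervalIntegrable_expTwoPi
      (φ := fun x => G x - θ * x) (hG.continuous.sub (continuous_const.mul continuous_id)) a b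
    have e2 : ‖∫ x in (M : ℝ)..p, expTwoPi (G x - θ * x)‖ ≤ 2 * (1 / θ) := by
      rcases hp1 with rfl | hp1
      · simpa using hθ.le
      refine (hG.norm_integral_le_of_le_abs (μ := θ / 2) hM0 hp.1 (by positivity)
        fun x hx => ?_).trans_eq (by field_simp)
      have := hp1 x hx
      exact le_abs.2 (Or.inr (by linarith))
    have e3 : ‖∫ x in p..((L - 1 : ℕ) : ℝ), expTwoPi (G x - θ * x)‖ ≤ 8 * W := by
      rcases hp2 with rfl | hp2
      · simpa using hW0
      have h1 := hp2 p (Set.left_mem_Icc.2 hp.2)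
      have h2 := hG.monotoneOn (hM0.trans hp.1) hX (hp.2.trans hLX)
      rw [hW, if_pos (by linarith)]
      refine (hG.norm_integral_le_of_le (hM0.trans hp.1) hp.2 hLX (half_pos hθ) h1).trans ?_
      have h3 : √(X / (θ / 2)) ≤ 2 * √(X / θ) := by
        rw [show (2 : ℝ) * √(X / θ) = √(2 ^ 2 * (X / θ)) by
          rw [Real.sqrt_mul (by positivity), Real.sqrt_sq (by norm_num)]]
        refine Real.sqrt_le_sqrt ?_
        rw [show X / (θ / 2) = 2 * (X / θ) by field_simp]
        have : 0 ≤ X / θ := by positivity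
        linarith
      linarith
    have e4 := norm_add_le_of_le e2 e3
    rw [intervalIntegral.integral_add_adjacent_intervals (hI _ _) (hI _ _)] at e4
    have := norm_add_le_of_le e1 e4
    rwa [sub_add_cancel] at this
  have e5 := norm_add_le_of_le hmain hbl
  rw [sub_add_cancel] at e5
  refine e5.trans ?_
  have e6 : 0 ≤ √(X * G₁ X) := Real.sqrt_nonneg _
  have e7 : 0 ≤ 1 / (1 - θ) := by
    have : 0 < 1 - θ := by linarith
    positivity
  have e8 : 0 ≤ G₁ X + √(X * G₁ X) + 1 / (1 - θ) := by positivity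
  nlinarith [mul_nonneg hK.le hθ'.le, mul_nonneg hK.le hW0, mul_nonneg hK'.le e8,
    mul_nonneg hK'.le hθ'.le, mul_nonneg hK'.le hW0]

/-! ### Fourier expansion modulo q and the average over frequencies b/q. -/

theorem sum_Icc_eq_sum_range_add {M : Type*} [AddCommGroup M] (F : ℕ → M) (N : ℕ) :
    ∑ y ∈ Finset.Icc 1 N, F y = ∑ y ∈ Finset.range N, F y + (F N - F 0) := by
  induction N with
  | zero => simp
  | succ N ih =>
    rw [Finset.sum_Icc_succ_top (by omega), ih, Finset.sum_range_succ]
    abel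

/-- Open the Gauss sum and sum over b first: orthogonality leaves only the residue z ≡ y. -/
theorem sum_gaussSumPoly_mul (q : ℕ) [NeZero q] (a : ℤ) (f : ℤ[X]) (y : ℤ) :
    ∑ b ∈ Finset.range q, gaussSumPoly q a b f * expTwoPi (-((b : ℝ) / q * y)) =
      q * expTwoPi ((a : ℝ) / q * realEval f y) := by
  set p := f.map (Int.castRingHom (ZMod q)) with hp
  have h1 : ∀ b : ℕ, gaussSumPoly q a b f * expTwoPi (-((b : ℝ) / q * y)) =
      ∑ z : ZMod q, ZMod.stdAddChar ((a : ZMod q) * p.eval z) *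
        ZMod.stdAddChar ((b : ZMod q) * (z - (y : ZMod q))) := by
    intro b
    have e1 : -((b : ℝ) / q * y) = ((-(b * y) : ℤ) : ℝ) / q := by push_cast; ring
    rw [e1, expTwoPi_intCast_div, gaussSumPoly_eq_completeSum, completeSum, Finset.sum_mul]
    refine Finset.sum_congr rfl fun z _ => ?_
    rw [← AddChar.map_add_eq_mul, ← AddChar.map_add_eq_mul]
    congr 1
    simp only [Polynomial.map_add, Polynomial.map_mul, map_C, map_X, eval_add, eval_mul, eval_C,
      eval_X, ← hp]
    simp
    ring
  simp only [h1]
  rw [sum_range_eq_sum_zmod q (fun b => ∑ z : ZMod q, ZMod.stdAddChar ((a : ZMod q) * p.eval z) *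
        ZMod.stdAddChar (b * (z - (y : ZMod q)))), Finset.sum_comm]
  simp only [← Finset.mul_sum]
  simp only [AddChar.sum_mulShift _ (ZMod.isPrimitive_stdAddChar q), sub_eq_zero, ZMod.card]
  simp only [mul_ite, Nat.cast_ite, Nat.cast_zero, mul_zero, Finset.sum_ite_eq', Finset.mem_univ,
    if_true]
  rw [mul_comm]
  congr 1
  have e2 : (a : ℝ) / q * realEval f y = ((a * f.eval y : ℤ) : ℝ) / q := by
    rw [realEval_intCast]; push_cast; ring
  rw [e2, expTwoPi_intCast_div, hp]
  congr 1
  have := eval_intCast_map (Int.castRingHom (ZMod q)) f y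
  rw [this]
  simp

/-- The sums `∑ e(G n - bn/q)` over `b` modulo `q` are small on average, apart from the main term
coming from `b = 0`. -/
theorem exists_sum_norm_le : ∃ K : ℝ, 0 < K ∧ ∀ G G₁ G₂ : ℝ → ℝ, IsConvexPhase G G₁ G₂ →
    ∀ X : ℝ, 0 ≤ X → ∀ q : ℕ, 0 < q →
      ‖∑ n ∈ Finset.Icc 1 ⌊X⌋₊, expTwoPi (G n) - ∫ x in (0 : ℝ)..X, expTwoPi (G x)‖ +
        ∑ b ∈ Finset.range (q - 1), ‖∑ n ∈ Finset.Icc 1 ⌊X⌋₊,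
          expTwoPi (G n - ((b + 1 : ℕ) : ℝ) / q * n)‖ ≤
      K * (q * (1 + Real.log q) * (1 + √(X * G₁ X))) := by
  obtain ⟨K₀, hK₀, h0⟩ := exists_norm_sum_sub_integral_zero_le
  obtain ⟨K₁, hK₁, h1⟩ := exists_norm_sum_le_of_pos
  refine ⟨2 * K₀ + 10 * K₁ + 4, by positivity, fun G G₁ G₂ hG X hX q hq => ?_⟩
  have hq1 : (1 : ℝ) ≤ q := by exact_mod_cast hq
  have hq0 : (0 : ℝ) < q := by linarith
  have hlog : 0 ≤ Real.log q := Real.log_nonneg hq1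
  have hqq : ((q - 1 : ℕ) : ℝ) ≤ q := by exact_mod_cast Nat.sub_le _ _
  set H := G₁ X with hH
  have hH0 : 0 ≤ H := hG.nonneg₁ X hX
  set Q := √(X * H) with hQ
  have hQ0 : 0 ≤ Q := Real.sqrt_nonneg _
  set A := q * (1 + Real.log q) with hA
  have hAq : (q : ℝ) ≤ A := by
    rw [hA]; nlinarith
  have hNX : (⌊X⌋₊ : ℝ) ≤ X := Nat.floor_le hX
  have hmain : 1 ≤ A * (1 + Q) := by nlinarith
  -- If X < H, the trivial bound X ≤ √(XH) is enough. Otherwise H ≤ √(XH), so the terms linear in H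
  -- are harmless.
  rcases lt_or_ge X H with hXH | hXH
  · have hXQ : X ≤ Q := by
      rw [hQ]
      exact Real.le_sqrt_of_sq_le (by nlinarith)
    have htriv : ∀ F : ℕ → ℝ, ‖∑ n ∈ Finset.Icc 1 ⌊X⌋₊, expTwoPi (F n)‖ ≤ X := fun F => by
      refine (norm_sum_le _ _).trans ?_
      simp only [norm_expTwoPi]
      simpa using hNX
    have e1 := norm_sub_le_of_le (htriv fun n => G n)
      (norm_integral_expTwoPi_le_sub (φ := G) hX)
    have e2 := Finset.sum_le_sum (s := Finset.range (q - 1)) fun b _ =>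
      htriv fun n => G n - ((b + 1 : ℕ) : ℝ) / q * n
    rw [Finset.sum_const, Finset.card_range, nsmul_eq_mul] at e2
    have e3 : ((q - 1 : ℕ) : ℝ) * X ≤ A * Q :=
      mul_le_mul (hqq.trans hAq) hXQ hX (by linarith)
    have e4 : X ≤ A * Q := by nlinarith
    have e5 : 0 ≤ A := by linarith
    nlinarith [mul_nonneg hK₀.le (mul_nonneg e5 hQ0), mul_nonneg hK₁.le (mul_nonneg e5 hQ0),
      mul_nonneg hK₀.le e5, mul_nonneg hK₁.le e5]
  have hHQ : H ≤ Q := Real.le_sqrt_of_sq_le (by nlinarith)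
  have hshift : ∀ F : ℕ → ℝ, ‖∑ n ∈ Finset.Icc 1 ⌊X⌋₊, expTwoPi (F n) -
      ∑ n ∈ Finset.range ⌊X⌋₊, expTwoPi (F n)‖ ≤ 2 := fun F => by
    rw [sum_Icc_eq_sum_range_add, add_sub_cancel_left]
    refine (norm_sub_le _ _).trans ?_
    rw [norm_expTwoPi, norm_expTwoPi]
    norm_num
  have e0 : ‖∑ n ∈ Finset.Icc 1 ⌊X⌋₊, expTwoPi (G n) - ∫ x in (0 : ℝ)..X, expTwoPi (G x)‖ ≤
      2 + K₀ * (1 + H + Q) := by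
    have := norm_add_le_of_le (hshift fun n => G n) (h0 G G₁ G₂ hG X hX)
    rwa [sub_add_sub_cancel] at this
  set w : ℕ → ℝ := fun b => if ((b : ℝ) + 1) / q ≤ 2 * H then √(X / (((b : ℝ) + 1) / q)) else 0
    with hw
  have e1 : ∀ b ∈ Finset.range (q - 1), ‖∑ n ∈ Finset.Icc 1 ⌊X⌋₊,
      expTwoPi (G n - ((b + 1 : ℕ) : ℝ) / q * n)‖ ≤
      (2 + K₁ * (1 + H + Q)) + K₁ * (q * (1 / ((b : ℝ) + 1)) +
        q * (1 / (((q - 1 - 1 - b : ℕ) : ℝ) + 1)) + w b) := by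
    intro b hb
    have hb' : b + 1 < q := by have := Finset.mem_range.1 hb; omega
    have hbR : (b : ℝ) + 1 < q := by exact_mod_cast hb'
    have hb0 : (0 : ℝ) ≤ b := Nat.cast_nonneg b
    have e2 := h1 G G₁ G₂ hG X (((b + 1 : ℕ) : ℝ) / q) hX (by positivity)
      ((div_lt_one hq0).2 (by exact_mod_cast hb'))
    have e3 := norm_add_le_of_le (hshift fun n => G n - ((b + 1 : ℕ) : ℝ) / q * n) e2
    rw [sub_add_cancel] at e3
    refine e3.trans_eq ?_
    have c1 : 1 / (((b + 1 : ℕ) : ℝ) / q) = q * (1 / ((b : ℝ) + 1)) := by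
      push_cast; field_simp
    have c2 : 1 / (1 - ((b + 1 : ℕ) : ℝ) / q) = q * (1 / (((q - 1 - 1 - b : ℕ) : ℝ) + 1)) := by
      have c3 : ((q - 1 - 1 - b : ℕ) : ℝ) + 1 = q - (b + 1) := by
        rw [show q - 1 - 1 - b = q - (b + 2) by omega, Nat.cast_sub (by omega)]
        push_cast; ring
      have c4 : (q : ℝ) - (b + 1) ≠ 0 := by linarith
      rw [c3]
      push_cast
      field_simp
    rw [c1, c2, hw]
    push_cast
    ring
  have hharm : ∑ b ∈ Finset.range (q - 1), 1 / ((b : ℝ) + 1) ≤ 1 + Real.log q := by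
    have g1 : ∑ b ∈ Finset.range (q - 1), 1 / ((b : ℝ) + 1) = ((harmonic (q - 1) : ℚ) : ℝ) := by
      rw [harmonic]
      push_cast
      simp only [one_div]
    rw [g1]
    rcases Nat.eq_zero_or_pos (q - 1) with g2 | g2
    · rw [g2]; simp; linarith
    refine (harmonic_le_one_add_log (q - 1)).trans ?_
    gcongr
  have hharm' : ∑ b ∈ Finset.range (q - 1), 1 / (((q - 1 - 1 - b : ℕ) : ℝ) + 1) ≤
      1 + Real.log q := by
    rw [Finset.sum_range_reflect (fun b : ℕ => 1 / ((b : ℝ) + 1)) (q - 1)]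
    exact hharm
  -- The stationary terms occur only for b + 1 ≤ 2Hq, and ∑ √(Xq/(b+1)) over that range is
  -- O(√(Xq)·√(Hq)) = O(q√(XH)).
  have hwsum : ∑ b ∈ Finset.range (q - 1), w b ≤ 4 * (q * Q) := by
    have hwle : ∑ b ∈ Finset.range (q - 1), w b ≤
        ∑ b ∈ Finset.range ⌊2 * H * q⌋₊, √(X * q) * (1 / √((b : ℝ) + 1)) := by
      rw [hw, ← Finset.sum_filter]
      refine (Finset.sum_le_sum_of_subset_of_nonneg (fun b hb => ?_)
        (fun _ _ _ => Real.sqrt_nonneg _)).trans_eq (Finset.sum_congr rfl fun b _ => ?_)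
      · have hb' := (Finset.mem_filter.1 hb).2
        rw [div_le_iff₀ hq0] at hb'
        rw [Finset.mem_range]
        exact Nat.lt_of_succ_le (Nat.le_floor (by push_cast; exact hb'))
      · rw [← Real.sqrt_one, ← Real.sqrt_div zero_le_one, Real.sqrt_one,
          ← Real.sqrt_mul (by positivity)]
        congr 1
        field_simp
    refine hwle.trans ?_
    rw [← Finset.mul_sum]
    calc √(X * q) * ∑ b ∈ Finset.range ⌊2 * H * q⌋₊, 1 / √((b : ℝ) + 1)
        ≤ √(X * q) * (2 * √(4 * (H * q))) := by
          refine mul_le_mul_of_nonneg_left ((sum_inv_sqrt_le _).trans ?_) (Real.sqrt_nonneg _)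
          refine mul_le_mul_of_nonneg_left (Real.sqrt_le_sqrt ?_) zero_le_two
          refine (Nat.floor_le (by positivity)).trans ?_
          have : 0 ≤ H * q := by positivity
          linarith
      _ = 2 * √((X * q) * (4 * (H * q))) := by
          rw [Real.sqrt_mul (show 0 ≤ X * q by positivity)]; ring
      _ = 2 * √((2 * q) ^ 2 * (X * H)) := by congr 2; ring
      _ = 4 * (q * Q) := by
          rw [Real.sqrt_mul (by positivity), Real.sqrt_sq (by positivity)]; ring
  have e2 := Finset.sum_le_sum e1
  rw [Finset.sum_add_distrib, Finset.sum_const, Finset.card_range, nsmul_eq_mul, ← Finset.mul_sum,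
    Finset.sum_add_distrib, Finset.sum_add_distrib, ← Finset.mul_sum, ← Finset.mul_sum] at e2
  have f1 : (q : ℝ) * ∑ b ∈ Finset.range (q - 1), 1 / ((b : ℝ) + 1) ≤ A :=
    mul_le_mul_of_nonneg_left hharm hq0.le
  have f2 : (q : ℝ) * ∑ b ∈ Finset.range (q - 1), 1 / (((q - 1 - 1 - b : ℕ) : ℝ) + 1) ≤ A :=
    mul_le_mul_of_nonneg_left hharm' hq0.le
  have f3 : (q : ℝ) * Q ≤ A * Q := mul_le_mul_of_nonneg_right hAq hQ0
  have f4 : ((q - 1 : ℕ) : ℝ) * (2 + K₁ * (1 + H + Q)) ≤ A * (2 + K₁ * (1 + 2 * Q)) :=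
    mul_le_mul (hqq.trans hAq) (by nlinarith) (by positivity) (by linarith)
  have f5 : 1 + H + Q ≤ 2 * (A * (1 + Q)) := by nlinarith
  have f6 : K₀ * (1 + H + Q) ≤ K₀ * (2 * (A * (1 + Q))) := mul_le_mul_of_nonneg_left f5 hK₀.le
  have f7 := mul_le_mul_of_nonneg_left (add_le_add (add_le_add f1 f2) (hwsum.trans
    (mul_le_mul_of_nonneg_left f3 (by norm_num)))) hK₁.le
  have e5 : 0 ≤ A := by linarith
  have f8 : 0 ≤ K₁ * A := mul_nonneg hK₁.le e5
  have f9 : 0 ≤ K₁ * (A * Q) := mul_nonneg hK₁.le (mul_nonneg e5 hQ0)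
  have f10 : 0 ≤ A * Q := mul_nonneg e5 hQ0
  nlinarith

/-! ### The polynomial as a convex phase, and the size of ψ(U) f'(ψ(U)). -/

theorem realEval_eq_eval_map (f : ℤ[X]) (x : ℝ) :
    realEval f x = (f.map (Int.castRingHom ℝ)).eval x := by
  rw [realEval, eval_map, aeval_def]
  rfl

theorem eval_nonneg_of_coeff_nonneg {p : ℝ[X]} (hp : ∀ n, 0 ≤ p.coeff n) {x : ℝ} (hx : 0 ≤ x) :
    0 ≤ p.eval x := by
  rw [eval_eq_sum_range]
  exact Finset.sum_nonneg fun n _ => mul_nonneg (hp n) (pow_nonneg hx n)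

theorem coeff_mul_nonneg {p r : ℝ[X]} (hp : ∀ n, 0 ≤ p.coeff n) (hr : ∀ n, 0 ≤ r.coeff n) (n : ℕ) :
    0 ≤ (p * r).coeff n := by
  rw [coeff_mul]
  exact Finset.sum_nonneg fun i _ => mul_nonneg (hp _) (hr _)

namespace IsAdmissible

variable {f : ℤ[X]}

theorem coeff_nonneg (hf : IsAdmissible f) (n : ℕ) : 0 ≤ (f.map (Int.castRingHom ℝ)).coeff n := by
  obtain ⟨α, hα, hfac⟩ := hf.roots
  have hprod : ∀ n, 0 ≤ (∏ j, (X + C (α j))).coeff n := by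
    refine Finset.prod_induction _ (fun p : ℝ[X] => ∀ n, 0 ≤ p.coeff n)
      (fun p r hp hr => coeff_mul_nonneg hp hr) (fun n => ?_) fun j _ n => ?_
    · rw [Polynomial.coeff_one]; split_ifs <;> norm_num
    · rw [coeff_add, coeff_X, coeff_C]
      have := hα j
      split_ifs <;> positivity
  have hl : (0 : ℝ) ≤ f.leadingCoeff := by exact_mod_cast hf.leadingCoeff_pos.le
  have h0 : (0 : ℝ) ≤ f.coeff 0 := by exact_mod_cast hf.coeff_zero
  rw [sub_eq_iff_eq_add.1 hfac, coeff_add]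
  refine add_nonneg (coeff_mul_nonneg (coeff_mul_nonneg (fun n => ?_) fun n => ?_) hprod n) ?_
  · rw [coeff_C]; split_ifs <;> simp [hl]
  · rw [coeff_X]; split_ifs <;> norm_num
  · rw [coeff_C]; split_ifs <;> simp [h0]

/-- All coefficients of f are nonnegative, so f' and f'' are nonnegative on [0, ∞). The only
negative coefficient that x f'' - f' could have is its constant term -a_1, which is zero. -/
theorem isConvexPhase (hf : IsAdmissible f) {β : ℝ} (hβ : 0 ≤ β) :
    IsConvexPhase (fun x => β * realEval f x)
      (fun x => β * (f.map (Int.castRingHom ℝ)).derivative.eval x)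
      (fun x => β * (f.map (Int.castRingHom ℝ)).derivative.derivative.eval x) := by
  set P := f.map (Int.castRingHom ℝ) with hP
  have hP0 : ∀ n, 0 ≤ P.coeff n := hf.coeff_nonneg
  have hP1 : ∀ n, 0 ≤ P.derivative.coeff n := fun n => by
    rw [coeff_derivative]
    exact mul_nonneg (hP0 _) (by positivity)
  have hP2 : ∀ n, 0 ≤ P.derivative.derivative.coeff n := fun n => by
    rw [coeff_derivative]
    exact mul_nonneg (hP1 _) (by positivity)
  refine ⟨fun x => ?_, fun x => (P.derivative.hasDerivAt x).const_mul β,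
    continuous_const.mul P.derivative.derivative.continuous,
    fun x hx => mul_nonneg hβ (eval_nonneg_of_coeff_nonneg hP1 hx),
    fun x hx => mul_nonneg hβ (eval_nonneg_of_coeff_nonneg hP2 hx), fun x hx => ?_⟩
  · simp only [realEval_eq_eval_map]
    exact (P.hasDerivAt x).const_mul β
  · have hcoeff : ∀ n, 0 ≤ (X * P.derivative.derivative - P.derivative).coeff n := by
      intro n
      rw [coeff_sub]
      rcases n with _ | n
      · rw [coeff_X_mul_zero, coeff_derivative, hP, coeff_map, zero_add, hf.coeff_one]
        simp
      · rw [coeff_X_mul, coeff_derivative]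
        have := mul_nonneg (hP1 (n + 1)) (Nat.cast_nonneg n : (0 : ℝ) ≤ n)
        linarith
    have h1 := eval_nonneg_of_coeff_nonneg hcoeff hx
    rw [eval_sub, eval_mul, eval_X] at h1
    have h2 := mul_nonneg hβ h1
    linarith

/-- Compare coefficients: n a_n ≤ d a_n. -/
theorem mul_eval_derivative_le (hf : IsAdmissible f) {x : ℝ} (hx : 0 ≤ x) :
    x * (f.map (Int.castRingHom ℝ)).derivative.eval x ≤ f.natDegree * realEval f x := by
  rw [realEval_eq_eval_map]
  set P := f.map (Int.castRingHom ℝ) with hP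
  have hP0 : ∀ n, 0 ≤ P.coeff n := hf.coeff_nonneg
  have hcoeff : ∀ n, 0 ≤ (C (f.natDegree : ℝ) * P - X * P.derivative).coeff n := by
    intro n
    rw [coeff_sub, coeff_C_mul]
    rcases n with _ | n
    · rw [coeff_X_mul_zero, sub_zero]
      exact mul_nonneg (Nat.cast_nonneg _) (hP0 0)
    · rw [coeff_X_mul, coeff_derivative]
      rcases le_or_gt (n + 1) f.natDegree with h | h
      · have h' : (n : ℝ) + 1 ≤ f.natDegree := by exact_mod_cast h
        have := mul_le_mul_of_nonneg_right h' (hP0 (n + 1))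
        linarith
      · have : P.coeff (n + 1) = 0 := by
          rw [hP, coeff_map, coeff_eq_zero_of_natDegree_lt h, map_zero]
        rw [this]
        simp
  have h1 := eval_nonneg_of_coeff_nonneg hcoeff hx
  rw [eval_sub, eval_mul, eval_mul, eval_X, eval_C] at h1
  linarith

theorem psi_mul_eval_derivative_le (hf : IsAdmissible f) {U : ℝ} (hU : 0 < U) :
    psi f U * (f.map (Int.castRingHom ℝ)).derivative.eval (psi f U) ≤ f.natDegree * U := by
  set S := {x : ℝ | 0 ≤ x ∧ realEval f x ≤ U} with hS
  have hdU : 0 ≤ (f.natDegree : ℝ) * U := by positivity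
  -- For a nonempty bounded closed set the supremum is attained, so f(ψ(U)) ≤ U. In the remaining
  -- cases `sSup` takes its default value 0 and the left side vanishes; for U < f(0) this is the
  -- intended ψ(U) = 0.
  by_cases hS' : S.Nonempty ∧ BddAbove S
  · have hcl : IsClosed S := by
      have h1 : Continuous (realEval f) := by
        have : realEval f = fun x => (f.map (Int.castRingHom ℝ)).eval x :=
          funext (realEval_eq_eval_map f)
        rw [this]
        exact (f.map (Int.castRingHom ℝ)).continuous
      exact (isClosed_le continuous_const continuous_id).inter (isClosed_le h1 continuous_const)
    have hmem : psi f U ∈ S := hcl.csSup_mem hS'.1 hS'.2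
    exact (hf.mul_eval_derivative_le hmem.1).trans
      (mul_le_mul_of_nonneg_left hmem.2 (Nat.cast_nonneg _))
  · have h0 : psi f U = 0 := by
      rw [not_and_or] at hS'
      rcases hS' with h | h
      · rw [psi, ← hS, Set.not_nonempty_iff_eq_empty.1 h, Real.sSup_empty]
      · exact Real.sSup_of_not_bddAbove h
    rw [h0, zero_mul]
    exact hdU

end IsAdmissible

/-! ### Assembling the approximation. -/

theorem psi_nonneg (f : ℤ[X]) (U : ℝ) : 0 ≤ psi f U :=
  Real.sSup_nonneg fun _ hx => hx.1

theorem conj_expSum (f : ℤ[X]) (U Θ : ℝ) :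
    (starRingEnd ℂ) (expSum f U Θ) = expSum f U (-Θ) := by
  simp only [expSum, map_sum, conj_expTwoPi, neg_mul]

theorem conj_majorArcApprox (f : ℤ[X]) (U Θ : ℝ) (q : ℕ) (a : ℤ) :
    (starRingEnd ℂ) (majorArcApprox f U Θ q a) = majorArcApprox f U (-Θ) q (-a) := by
  simp only [majorArcApprox, gaussSumPoly, vInt, map_mul, map_inv₀, map_natCast, map_sum,
    conj_expTwoPi, ← intervalIntegral.intervalIntegral_conj]
  congr 2
  · congr 1
    funext y
    congr 1
    push_cast
    ring
  · funext x
    congr 1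
    push_cast
    ring

/-- The approximation to the exponential sum for `β ≥ 0`. -/
theorem exists_norm_expSum_sub_le {f : ℤ[X]} (hf : IsAdmissible f) {ε : ℝ} (hε : 0 < ε) :
    ∃ K : ℝ, 0 < K ∧ ∀ U : ℝ, 0 < U → ∀ (a : ℤ) (q : ℕ), 0 < q → IsCoprime a (q : ℤ) →
      ∀ β : ℝ, 0 ≤ β →
        ‖expSum f U ((a : ℝ) / q + β) - majorArcApprox f U ((a : ℝ) / q + β) q a‖ ≤
          K * (q : ℝ) ^ (1 - (2 : ℝ) ^ (1 - (f.natDegree : ℝ)) + ε) *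
            (1 + U * β) ^ (1 / 2 : ℝ) := by
  -- Half of ε goes to the Gauss sums, the other half absorbs 1 + log q.
  obtain ⟨K₁, hK₁, hS⟩ := exists_norm_gaussSumPoly_le hf.two_le (half_pos hε)
  obtain ⟨K₂, hK₂, hT⟩ := exists_sum_norm_le
  refine ⟨K₁ * K₂ * (1 + 1 / (ε / 2)) * (1 + √f.natDegree), by positivity,
    fun U hU a q hq haq β hβ => ?_⟩
  have : NeZero q := ⟨hq.ne'⟩
  have hq1 : (1 : ℝ) ≤ q := by exact_mod_cast hq
  have hq0 : (0 : ℝ) < q := by linarith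
  have hqC : (q : ℂ) ≠ 0 := by exact_mod_cast hq.ne'
  set e := 1 - (2 : ℝ) ^ (1 - (f.natDegree : ℝ)) with he
  set X := psi f U with hX
  have hX0 : 0 ≤ X := psi_nonneg f U
  have hphase := hf.isConvexPhase hβ
  set D := (f.map (Int.castRingHom ℝ)).derivative.eval X with hD
  have hXH : X * (β * D) ≤ f.natDegree * (U * β) := by
    have := mul_le_mul_of_nonneg_left (hf.psi_mul_eval_derivative_le hU) hβ
    linarith
  set T : ℕ → ℂ := fun b => ∑ n ∈ Finset.Icc 1 ⌊X⌋₊, expTwoPi (β * realEval f n - (b : ℝ) / q * n)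
    with hTdef
  have hsum : expSum f U ((a : ℝ) / q + β) =
      (q : ℂ)⁻¹ * ∑ b ∈ Finset.range q, gaussSumPoly q a b f * T b := by
    rw [eq_inv_mul_iff_mul_eq₀ hqC, expSum, Finset.mul_sum]
    simp only [hTdef, Finset.mul_sum]
    rw [Finset.sum_comm]
    refine Finset.sum_congr rfl fun n _ => ?_
    have h1 := sum_gaussSumPoly_mul q a f n
    rw [Int.cast_natCast] at h1
    rw [add_mul, expTwoPi_add, ← mul_assoc, ← h1, Finset.sum_mul]
    refine Finset.sum_congr rfl fun b _ => ?_
    rw [mul_assoc, ← expTwoPi_add]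
    congr 2
    ring
  have hmaj : majorArcApprox f U ((a : ℝ) / q + β) q a =
      (q : ℂ)⁻¹ * (gaussSumPoly q a 0 f * ∫ x in (0 : ℝ)..X, expTwoPi (β * realEval f x)) := by
    rw [majorArcApprox, vInt, add_sub_cancel_left, mul_assoc]
  obtain ⟨q', rfl⟩ : ∃ q', q = q' + 1 := ⟨q - 1, by omega⟩
  have hT' := hT _ _ _ hphase X hX0 (q' + 1) hq
  rw [Nat.add_sub_cancel] at hT'
  set B := K₁ * ((q' + 1 : ℕ) : ℝ) ^ (e + ε / 2) with hB
  have hB0 : 0 < B := by positivity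
  have hSB : ∀ b : ℤ, ‖gaussSumPoly (q' + 1) a b f‖ ≤ B := fun b => hS (q' + 1) hq a b haq
  have hdiff : ‖∑ b ∈ Finset.range (q' + 1), gaussSumPoly (q' + 1) a b f * T b -
      gaussSumPoly (q' + 1) a 0 f * ∫ x in (0 : ℝ)..X, expTwoPi (β * realEval f x)‖ ≤
      B * (K₂ * (((q' + 1 : ℕ) : ℝ) * (1 + Real.log ((q' + 1 : ℕ) : ℝ)) * (1 + √(X * (β * D))))) := by
    rw [Finset.sum_range_succ', Nat.cast_zero, add_sub_assoc, ← mul_sub, add_comm]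
    refine le_trans ?_ (mul_le_mul_of_nonneg_left hT' hB0.le)
    rw [mul_add, Finset.mul_sum]
    refine norm_add_le_of_le ?_ (norm_sum_le_of_le _ fun b _ => ?_)
    · rw [norm_mul]
      refine mul_le_mul (hSB 0) (le_of_eq ?_) (norm_nonneg _) hB0.le
      simp only [hTdef, Nat.cast_zero, zero_div, zero_mul, sub_zero]
    · rw [norm_mul]
      exact mul_le_mul_of_nonneg_right (hSB _) (norm_nonneg _)
  rw [hsum, hmaj, ← mul_sub, norm_mul, norm_inv, Complex.norm_natCast]
  set r : ℝ := ((q' + 1 : ℕ) : ℝ) with hr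
  have hlog : 1 + Real.log r ≤ (1 + 1 / (ε / 2)) * r ^ (ε / 2) := by
    have h1 := Real.log_le_rpow_div hq0.le (half_pos hε)
    have h2 := Real.one_le_rpow hq1 (half_pos hε).le
    have h3 : (1 + 1 / (ε / 2)) * r ^ (ε / 2) = r ^ (ε / 2) + r ^ (ε / 2) / (ε / 2) := by ring
    rw [h3]
    exact add_le_add h2 h1
  have hlog0 : 0 ≤ Real.log r := Real.log_nonneg hq1
  have hUβ : 0 ≤ U * β := by positivity
  have hroot : 1 + √(X * (β * D)) ≤ (1 + √f.natDegree) * (1 + U * β) ^ (1 / 2 : ℝ) := by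
    rw [← Real.sqrt_eq_rpow]
    have h1 : √(X * (β * D)) ≤ √f.natDegree * √(1 + U * β) := by
      rw [← Real.sqrt_mul (Nat.cast_nonneg _)]
      refine Real.sqrt_le_sqrt (hXH.trans ?_)
      exact mul_le_mul_of_nonneg_left (by linarith) (Nat.cast_nonneg _)
    have h2 : 1 ≤ √(1 + U * β) := Real.one_le_sqrt.2 (by linarith)
    linarith
  calc r⁻¹ * _ ≤ r⁻¹ * (B * (K₂ * (r * (1 + Real.log r) * (1 + √(X * (β * D)))))) :=
        mul_le_mul_of_nonneg_left hdiff (by positivity)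
    _ = B * K₂ * ((1 + Real.log r) * (1 + √(X * (β * D)))) := by
        field_simp
    _ ≤ B * K₂ * (((1 + 1 / (ε / 2)) * r ^ (ε / 2)) *
          ((1 + √f.natDegree) * (1 + U * β) ^ (1 / 2 : ℝ))) := by
        refine mul_le_mul_of_nonneg_left ?_ (by positivity)
        exact mul_le_mul hlog hroot (by positivity) (by positivity)
    _ = K₁ * K₂ * (1 + 1 / (ε / 2)) * (1 + √f.natDegree) * (r ^ (e + ε / 2) * r ^ (ε / 2)) *
          (1 + U * β) ^ (1 / 2 : ℝ) := by
        rw [hB]; ring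
    _ = _ := by
        rw [← Real.rpow_add hq0, add_assoc, add_halves]

theorem lemma2 (f : Polynomial ℤ) (hf : IsAdmissible f) (ε : ℝ) (hε : 0 < ε) :
    ∃ C : ℝ, 0 < C ∧ ∀ U : ℝ, 0 < U → ∀ a q : ℕ, 0 < q → Nat.Coprime a q →
      ∀ Θ β : ℝ, Θ = (a : ℝ) / (q : ℝ) + β → |β| ≤ 1 / (q : ℝ) →
        ‖expSum f U Θ - majorArcApprox f U Θ q a‖ ≤
          C * (q : ℝ) ^ (1 - (2 : ℝ) ^ (1 - (f.natDegree : ℝ)) + ε) *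
            (1 + U * |β|) ^ (1 / 2 : ℝ) := by
  obtain ⟨K, hK, h⟩ := exists_norm_expSum_sub_le hf hε
  refine ⟨K, hK, fun U hU a q hq haq Θ β hΘ _ => ?_⟩
  have hcop : IsCoprime (a : ℤ) (q : ℤ) := Nat.isCoprime_iff_coprime.2 haq
  subst hΘ
  -- For β ≤ 0, conjugation replaces (a, β) by (-a, -β) and preserves norms; this is why the
  -- preceding estimate allows any integer a.
  rcases le_total 0 β with hβ | hβ
  · rw [abs_of_nonneg hβ]
    simpa using h U hU a q hq hcop β hβ
  · rw [abs_of_nonpos hβ]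
    have h1 := h U hU (-a) q hq hcop.neg_left (-β) (by linarith)
    have h2 : ((-(a : ℤ) : ℤ) : ℝ) / q + -β = -((a : ℝ) / q + β) := by push_cast; ring
    rwa [h2, ← conj_expSum, ← conj_majorArcApprox, ← map_sub, RCLike.norm_conj] at h1
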